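/- All graphs are finite, simple and undirected, and are considered up to isomorphism. A graph is biconnected if it has at least two vertices and any two distinct vertices lie on a common cycle. The blocks of a graph $G$ are its isolated vertices, its bridges (a bridge together with its two endpoints) and its maximal biconnected subgraphs; ${\sf bc}(G)$ is the set of blocks of $G$, and $G$ is a block-graph if ${\sf bc}(G)=\{G\}$. For a class ${\cal G}$ of graphs, the block elimination distance ${\sf bed}_{\cal G}(G)$ is $0$ if $G\in{\cal G}$; it is $1+\min\{{\sf bed}_{\cal G}(G\setminus v)\mid v\in V(G)\}$ if $G\notin{\cal G}$ is a block-graph; and it is $\max\{{\sf bed}_{\cal G}(B)\mid B\in{\sf bc}(G)\}$ if $G\notin{\cal G}$ is not a block-graph. Put ${\cal G}^{(k)}=\{G\mid {\sf bed}_{\cal G}(G)\le k\}$, let ${\cal E}$ be the class of edgeless graphs, and for a class ${\cal Q}$ let ${\sf obs}({\cal Q})$ be the set of minor-minimal graphs that do not belong to ${\cal Q}$. **Lemma.** ${\sf obs}({\cal E}^{(1)})=\{K_3\}$, and ${\sf obs}({\cal E}^{(2)})=\{Z_1,Z_2,Z_3\}$ for the following three pairwise non-isomorphic graphs: $Z_1$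 is the graph on $6$ vertices obtained from a triangle by adding, for each of its three edges, a new vertex adjacent to exactly the two endpoints of that edge; $Z_2=K_4$; and $Z_3$ is the graph on $6$ vertices obtained from two vertex-disjoint triangles $a_1a_2a_3$ and $b_1b_2b_3$ by adding the two edges $a_1b_1$ and $a_2b_2$. -/

import Mathlib

universe u

/-- A finite simple graph, bundled with its vertex type. -/
structure FinGraph : Type (u + 1) where
  V : Type u
  graph : SimpleGraph V
  [finite : Finite V]

attribute [instance] FinGraph.finite

namespace FinGraph

/-- The graph `G` with the vertex `v` removed. -/
def deleteVertex (G : FinGraph.{u}) (v : G.V) : FinGraph.{u} where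
  V := ({v}ᶜ : Set G.V)
  graph := G.graph.induce {v}ᶜ

/-- A subgraph of `G`, seen as a graph in its own right. -/
def ofSubgraph (G : FinGraph.{u}) (B : G.graph.Subgraph) : FinGraph.{u} where
  V := B.verts
  graph := B.coe

/-- Two graphs (possibly with vertex types in different universes) are isomorphic. -/
def IsoTo (G : FinGraph.{u}) {W : Type*} (H : SimpleGraph W) : Prop :=
  Nonempty (G.graph ≃g H)

/-- `H` is a minor of `G`: there are pairwise disjoint sets of vertices of `G`, one for each vertex
of `H`, each inducing a connected (hence nonempty) subgraph, such that the sets of adjacent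
vertices of `H` are joined by an edge of `G`. -/
def IsMinor (H G : FinGraph.{u}) : Prop :=
  ∃ β : H.V → Set G.V,
    (∀ x, (G.graph.induce (β x)).Connected) ∧
    (∀ x y, x ≠ y → Disjoint (β x) (β y)) ∧
    (∀ x y, H.graph.Adj x y → ∃ a ∈ β x, ∃ b ∈ β y, G.graph.Adj a b)

end FinGraph

namespace SimpleGraph

variable {V : Type u}

/-- Any two distinct vertices lie on a common cycle; graphs with at most one vertex are not counted
as biconnected. -/
def IsBiconnected (G : SimpleGraph V) : Prop :=
  Nontrivial V ∧ ∀ x y : V, x ≠ y →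
    ∃ (a : V) (c : G.Walk a a), c.IsCycle ∧ x ∈ c.support ∧ y ∈ c.support

/-- The blocks of `G`: its isolated vertices, its bridges (as subgraphs with two vertices and one
edge), and its biconnected components, that is, its maximal biconnected subgraphs. -/
def blocks (G : SimpleGraph V) : Set G.Subgraph :=
  {B | (∃ v, G.IsIsolated v ∧ B = G.singletonSubgraph v) ∨
    (∃ (x y : V) (h : G.Adj x y), G.IsBridge s(x, y) ∧ B = G.subgraphOfAdj h) ∨
    Maximal (fun H : G.Subgraph => H.coe.IsBiconnected) B}

/-- `G` is a block-graph: it is its own unique block. -/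
def IsBlockGraph (G : SimpleGraph V) : Prop :=
  G.blocks = {⊤}

theorem IsBiconnected.exists_cycle_of_subgraph {G : SimpleGraph V} {B : G.Subgraph}
    (h : B.coe.IsBiconnected) {x y : V} (hx : x ∈ B.verts) (hy : y ∈ B.verts) (hxy : x ≠ y) :
    ∃ (a : V) (c : G.Walk a a), c.IsCycle ∧ x ∈ c.support ∧ y ∈ c.support := by
  obtain ⟨a, c, hc, h1, h2⟩ := h.2 ⟨x, hx⟩ ⟨y, hy⟩ (by simpa [Subtype.ext_iff] using hxy)
  refine ⟨_, c.map B.hom, hc.map Subgraph.hom_injective, ?_, ?_⟩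
  · rw [Walk.support_map, List.mem_map]
    exact ⟨_, h1, rfl⟩
  · rw [Walk.support_map, List.mem_map]
    exact ⟨_, h2, rfl⟩

theorem not_isBridge_of_mem_cycle {G : SimpleGraph V} {x y a : V} {c : G.Walk a a}
    (hc : c.IsCycle) (hx : x ∈ c.support) (hy : y ∈ c.support) : ¬ G.IsBridge s(x, y) := by
  classical
  rw [isBridge_iff, not_not]
  have hc' := hc.rotate hx
  have hy' : y ∈ (c.rotate x hx).support := by
    by_cases hxy : y = x
    · subst hxy; simp
    · exact (Walk.mem_support_rotate_iff ..).2 hy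
  generalize c.rotate x hx = d at hc' hy'
  have hnd := hc'.isTrail.edges_nodup
  rw [← d.take_spec hy', Walk.edges_append, List.nodup_append] at hnd
  by_cases he : s(x, y) ∈ (d.takeUntil y hy').edges
  · refine ((d.dropUntil y hy').toDeleteEdges {s(x, y)} ?_).reachable.symm
    intro e h1 h2
    rw [Set.mem_singleton_iff] at h2
    subst h2
    exact hnd.2.2 _ he _ h1 rfl
  · refine ((d.takeUntil y hy').toDeleteEdges {s(x, y)} ?_).reachable
    intro e h1 h2
    rw [Set.mem_singleton_iff] at h2
    subst h2
    exact he h1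

/-- A spanning block is the whole graph. -/
theorem eq_top_of_mem_blocks {G : SimpleGraph V} {B : G.Subgraph} (hB : B ∈ G.blocks)
    (hu : B.verts = Set.univ) : B = ⊤ := by
  have hmem : ∀ v, v ∈ B.verts := fun v => hu ▸ Set.mem_univ v
  rcases hB with ⟨v, hv, rfl⟩ | ⟨x, y, h, -, rfl⟩ | hB
  · refine Subgraph.ext hu ?_
    ext a b
    have ha : a = v := by simpa using hmem a
    subst ha
    simpa using hv b
  · refine Subgraph.ext hu ?_
    ext a b
    have ha : a = x ∨ a = y := by simpa using hmem a
    have hb : b = x ∨ b = y := by simpa using hmem b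
    rcases ha with rfl | rfl <;> rcases hb with rfl | rfl <;>
      simp [h, h.symm, h.ne, h.ne.symm]
  · refine hB.eq_of_le ?_ le_top
    obtain ⟨p, q, hpq⟩ := hB.prop.1
    refine ⟨⟨⟨p, trivial⟩, ⟨q, trivial⟩, by simpa [Subtype.ext_iff] using hpq⟩, ?_⟩
    intro x y hxy
    obtain ⟨a, c, hc, h1, h2⟩ := hB.prop.exists_cycle_of_subgraph (hmem x.1) (hmem y.1)
      (by simpa [Subtype.ext_iff] using hxy)
    refine ⟨_, c.map (Subgraph.topIso (G := G)).symm.toHom,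
      hc.map (Subgraph.topIso (G := G)).symm.injective, ?_, ?_⟩
    · rw [Walk.support_map, List.mem_map]
      exact ⟨_, h1, rfl⟩
    · rw [Walk.support_map, List.mem_map]
      exact ⟨_, h2, rfl⟩

/-- If `G` is one of its own blocks, then it has no other block. -/
theorem isBlockGraph_of_top_mem {G : SimpleGraph V} (hG : ⊤ ∈ G.blocks) : G.IsBlockGraph := by
  refine Set.eq_singleton_iff_unique_mem.2 ⟨hG, fun C hC => ?_⟩
  rcases hG with ⟨v, hv, h⟩ | ⟨x, y, hxy, -, h⟩ | hG
  · have hV : ∀ a, a = v := fun a => by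
      have : a ∈ (⊤ : G.Subgraph).verts := trivial
      rw [h] at this
      simpa using this
    refine eq_top_of_mem_blocks hC (Set.eq_univ_of_forall fun a => ?_)
    rcases hC with ⟨w, -, rfl⟩ | ⟨p, q, hpq, -, rfl⟩ | hC
    · simp [hV a, hV w]
    · exact absurd ((hV p).trans (hV q).symm) hpq.ne
    · obtain ⟨p, q, hpq⟩ := hC.prop.1
      exact absurd (Subtype.ext ((hV p).trans (hV q).symm)) hpq
  · have hV : ∀ a, a = x ∨ a = y := fun a => by
      have : a ∈ (⊤ : G.Subgraph).verts := trivial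
      rw [h] at this
      simpa using this
    have key : ∀ p q : V, p ≠ q → ∀ a, a = p ∨ a = q := by
      intro p q hpq a
      rcases hV a with ha | ha <;> rcases hV p with hp | hp <;> rcases hV q with hq | hq <;>
        simp_all
    refine eq_top_of_mem_blocks hC (Set.eq_univ_of_forall fun a => ?_)
    rcases hC with ⟨w, hw, rfl⟩ | ⟨p, q, hpq, -, rfl⟩ | hC
    · rcases hV w with rfl | rfl
      · exact absurd hxy (hw _)
      · exact absurd hxy.symm (hw _)
    · simpa using key p q hpq.ne a
    · obtain ⟨p, q, hpq⟩ := hC.prop.1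
      rcases key p q (fun e => hpq (Subtype.ext e)) a with rfl | rfl
      · exact p.2
      · exact q.2
  · have hcyc : ∀ x y : V, x ≠ y →
        ∃ (a : V) (c : G.Walk a a), c.IsCycle ∧ x ∈ c.support ∧ y ∈ c.support :=
      fun x y hxy => hG.prop.exists_cycle_of_subgraph trivial trivial hxy
    rcases hC with ⟨w, hw, rfl⟩ | ⟨p, q, hpq, hb, rfl⟩ | hC
    · classical
      have : Nontrivial (⊤ : G.Subgraph).verts := hG.prop.1
      obtain ⟨z, hz⟩ := exists_ne (⟨w, trivial⟩ : (⊤ : G.Subgraph).verts)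
      obtain ⟨a, c, hc, h1, -⟩ := hcyc w z.1 (fun e => hz (Subtype.ext e.symm))
      exact absurd (Walk.adj_snd (hc.rotate h1).not_nil) (hw _)
    · obtain ⟨a, c, hc, h1, h2⟩ := hcyc p q hpq.ne
      exact absurd hb (not_isBridge_of_mem_cycle hc h1 h2)
    · exact hC.eq_of_le hG.prop le_top

end SimpleGraph

namespace FinGraph

/-- The blocks of a graph that is not a block-graph have fewer vertices than the graph. -/
theorem card_ofSubgraph_lt {G : FinGraph.{u}} (h : ¬ G.graph.IsBlockGraph)
    {B : G.graph.Subgraph} (hB : B ∈ G.graph.blocks) :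
    Nat.card (G.ofSubgraph B).V < Nat.card G.V := by
  have hne : B.verts ≠ Set.univ := fun hu =>
    h (SimpleGraph.isBlockGraph_of_top_mem (SimpleGraph.eq_top_of_mem_blocks hB hu ▸ hB))
  have := Set.ncard_lt_card hne
  rwa [← Nat.card_coe_set_eq] at this

theorem card_deleteVertex_lt (G : FinGraph.{u}) (v : G.V) :
    Nat.card (G.deleteVertex v).V < Nat.card G.V := by
  have hne : ({v}ᶜ : Set G.V) ≠ Set.univ := fun hu => by
    have : v ∈ ({v}ᶜ : Set G.V) := hu ▸ Set.mem_univ v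
    exact this rfl
  have := Set.ncard_lt_card hne
  rwa [← Nat.card_coe_set_eq] at this

/-- The block elimination distance of `G` to the class `𝒢`: it is `0` for members of `𝒢`; otherwise
it is one plus the minimum over the deletions of one vertex if `G` is a block-graph, and the
maximum over the blocks of `G` if it is not. -/
noncomputable def bed (𝒢 : Set FinGraph.{u}) (G : FinGraph.{u}) : ℕ∞ :=
  open Classical in
  if G ∈ 𝒢 then 0
  else if h : G.graph.IsBlockGraph then 1 + ⨅ v : G.V, bed 𝒢 (G.deleteVertex v)
  else ⨆ B : {B : G.graph.Subgraph // B ∈ G.graph.blocks}, bed 𝒢 (G.ofSubgraph B.1)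
termination_by Nat.card G.V
decreasing_by
  · exact G.card_deleteVertex_lt v
  · exact card_ofSubgraph_lt h B.2

/-- The class of the graphs whose block elimination distance to `𝒢` is at most `k`. -/
def bedLE (𝒢 : Set FinGraph.{u}) (k : ℕ) : Set FinGraph.{u} :=
  {G | G.bed 𝒢 ≤ k}

/-- The minor-minimal graphs that do not belong to `𝒬`. -/
def obs (𝒬 : Set FinGraph.{u}) : Set FinGraph.{u} :=
  {G | G ∉ 𝒬 ∧ ∀ H : FinGraph.{u}, H.IsMinor G → H ∉ 𝒬 → H.IsoTo G.graph}

/-- The class of the edgeless graphs. -/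
def edgeless : Set FinGraph.{u} :=
  {G | G.graph = ⊥}

/-- A triangle `0 1 2`, for each of whose edges there is one more vertex, adjacent to its two
ends. -/
def threeSun : SimpleGraph (Fin 6) :=
  SimpleGraph.fromEdgeSet
    {s(0, 1), s(1, 2), s(2, 0), s(3, 0), s(3, 1), s(4, 1), s(4, 2), s(5, 2), s(5, 0)}

/-- Two disjoint triangles `0 1 2` and `3 4 5`, joined by the two disjoint edges `0 3`, `1 4`. -/
def twoJoinedTriangles : SimpleGraph (Fin 6) :=
  SimpleGraph.fromEdgeSet
    {s(0, 1), s(1, 2), s(2, 0), s(3, 4), s(4, 5), s(5, 3), s(0, 3), s(1, 4)}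

end FinGraph

/-! Distance at most 1 means acyclic: blocks of a forest have at most two vertices, while deleting
one vertex from a graph with a cycle always leaves an edge. Every cycle contracts to a triangle,
which settles the first obstruction set.

Call a vertex a hub if it meets all cycles. A biconnected graph with a hub has distance at most 2,
one without a hub has distance at least 3, and a graph of distance above 2 is, or has as a block, a
biconnected graph without a hub. The core is thus `IsBiconnectedWithoutHub.exists_isMinorOf`: such a
graph `G` has one of the three graphs as a minor. Conversely these three are biconnected without a
hub, and none is a minor of another, so all three are minimal.

For the core, take a maximal subgraph `H` of `G` that has no cut vertex but has a hub `v`. As `G`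
has no hub, `H ≠ G` and there is an ear with ends `x`, `y`. By maximality no vertex of `H` is a hub
after the ear is added. Deleting `x` or `y` turns the ear into a pendant path, so neither is a hub
even of `H`. Hence, in the forest `T = H - v`, two neighbours of `v` are joined avoiding `x`, and
two are joined avoiding `y`.

Let the side of `x` be `x` with everything it separates from `y` in `T`, and likewise for `y`. Each
side contains a neighbour of `v`, since `H` has no cut vertex. The forest and the ear give two
disjoint links between `x` and `y`. A neighbour of `v` on neither side gives `K₄`. Otherwise, if two
neighbours of `v` on one side are joined without passing its end, two joined triangles arise. In the
remaining case each side holds two neighbours of `v` in separate pieces, and the sun arises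
(`isMinorOf_of_side_links`). -/

namespace SimpleGraph

variable {V W X : Type*}

/-! ### Connected sets and the minor order -/

/-- Minors of simple graphs, with vertex types in arbitrary universes. -/
def IsMinorOf (H : SimpleGraph W) (G : SimpleGraph V) : Prop :=
  ∃ β : W → Set V,
    (∀ x, (G.induce (β x)).Connected) ∧
    (∀ x y, x ≠ y → Disjoint (β x) (β y)) ∧
    (∀ x y, H.Adj x y → ∃ a ∈ β x, ∃ b ∈ β y, G.Adj a b)

theorem connected_induce_mono {G H : SimpleGraph V} (h : G ≤ H) {s : Set V}
    (hs : (G.induce s).Connected) : (H.induce s).Connected :=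
  hs.mono (comap_monotone _ h)

/-- A set that can be left along an edge only from `x`, and all of whose elements are joined
to `x`, is connected. -/
theorem connected_induce_of_closed {G : SimpleGraph V} {s : Set V} {x : V} (hx : x ∈ s)
    (hr : ∀ a ∈ s, G.Reachable a x) (hcl : ∀ a ∈ s, a ≠ x → ∀ b, G.Adj a b → b ∈ s) :
    (G.induce s).Connected := by
  have key : ∀ a (_ : G.Walk a x) (ha : a ∈ s), (G.induce s).Reachable ⟨a, ha⟩ ⟨x, hx⟩ := by
    intro a p
    induction p with
    | nil => intro ha; exact Reachable.refl _
    | @cons u v w h p ih =>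
      intro ha
      by_cases hax : u = w
      · subst hax; exact Reachable.refl _
      · have hv := hcl u ha hax v h
        exact (Adj.reachable (show (G.induce s).Adj ⟨u, ha⟩ ⟨v, hv⟩ from h)).trans
          (ih hx hr (fun a ha hne => hcl a ha hne) hv)
  rw [connected_iff_exists_forall_reachable]
  refine ⟨⟨x, hx⟩, fun ⟨a, ha⟩ => ?_⟩
  obtain ⟨p⟩ := hr a ha
  exact (key a p ha).symm

theorem connected_induce_singleton (G : SimpleGraph V) (v : V) :
    (G.induce {v}).Connected :=
  connected_induce_of_closed rfl (fun a ha => by rw [Set.mem_singleton_iff.1 ha])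
    (fun a ha hne => absurd ha hne)

/-- Makes minors compose: branch sets over a connected set of vertices merge into one branch set. -/
theorem connected_induce_iUnion {G : SimpleGraph V} {H : SimpleGraph X} {β : X → Set V}
    (hβ : ∀ x, (G.induce (β x)).Connected)
    (hadj : ∀ x y, H.Adj x y → ∃ a ∈ β x, ∃ b ∈ β y, G.Adj a b) {s : Set X}
    (hs : (H.induce s).Connected) : (G.induce (⋃ x ∈ s, β x)).Connected := by
  set U := ⋃ x ∈ s, β x with hU
  have hsub : ∀ x ∈ s, β x ⊆ U := fun x hx => Set.subset_biUnion_of_mem hx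
  have h1 : ∀ x (hx : x ∈ s) a b (ha : a ∈ β x) (hb : b ∈ β x),
      (G.induce U).Reachable ⟨a, hsub x hx ha⟩ ⟨b, hsub x hx hb⟩ := fun x hx a b ha hb =>
    ((hβ x).preconnected ⟨a, ha⟩ ⟨b, hb⟩).map (induceHomOfLE G (hsub x hx)).toHom
  have h2 : ∀ x y : s, (H.induce s).Walk x y → ∀ a b (ha : a ∈ β x) (hb : b ∈ β y),
      (G.induce U).Reachable ⟨a, hsub x x.2 ha⟩ ⟨b, hsub y y.2 hb⟩ := by
    intro x y p
    induction p with
    | nil => intro a b ha hb; exact h1 _ (Subtype.coe_prop _) a b ha hb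
    | @cons u v w h p ih =>
      intro a b ha hb
      obtain ⟨c, hc, d, hd, hcd⟩ := hadj u v h
      exact ((h1 u u.2 a c ha hc).trans (Adj.reachable
        (show (G.induce U).Adj ⟨c, hsub u u.2 hc⟩ ⟨d, hsub v v.2 hd⟩ from hcd))).trans
        (ih d b hd hb)
  obtain ⟨x⟩ := hs.nonempty
  obtain ⟨a⟩ := (hβ x).nonempty
  rw [connected_iff_exists_forall_reachable]
  refine ⟨⟨a, hsub x x.2 a.2⟩, fun ⟨b, hb⟩ => ?_⟩
  obtain ⟨y, hy, hby⟩ := Set.mem_iUnion₂.1 hb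
  obtain ⟨p⟩ := hs.preconnected x ⟨y, hy⟩
  exact h2 _ _ p a b a.2 hby

namespace IsMinorOf

theorem trans {K : SimpleGraph W} {H : SimpleGraph X} {G : SimpleGraph V}
    (h₁ : K.IsMinorOf H) (h₂ : H.IsMinorOf G) : K.IsMinorOf G := by
  obtain ⟨γ, hγc, hγd, hγa⟩ := h₁
  obtain ⟨β, hβc, hβd, hβa⟩ := h₂
  refine ⟨fun w => ⋃ x ∈ γ w, β x, fun w => connected_induce_iUnion hβc hβa (hγc w), ?_, ?_⟩
  · intro w w' hne
    rw [Set.disjoint_left]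
    intro a ha ha'
    obtain ⟨x, hx, hax⟩ := Set.mem_iUnion₂.1 ha
    obtain ⟨y, hy, hay⟩ := Set.mem_iUnion₂.1 ha'
    refine Set.disjoint_left.1 (hβd x y ?_) hax hay
    rintro rfl
    exact Set.disjoint_left.1 (hγd w w' hne) hx hy
  · intro w w' h
    obtain ⟨x, hx, y, hy, hxy⟩ := hγa w w' h
    obtain ⟨a, ha, b, hb, hab⟩ := hβa x y hxy
    exact ⟨a, Set.mem_biUnion hx ha, b, Set.mem_biUnion hy hb, hab⟩

theorem of_hom {H : SimpleGraph W} {G : SimpleGraph V} (f : H →g G)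
    (hf : Function.Injective f) : H.IsMinorOf G :=
  ⟨fun x => {f x}, fun x => connected_induce_singleton G _,
    fun x y hne => by simpa using fun h => hne (hf h),
    fun x y h => ⟨_, rfl, _, rfl, f.map_rel h⟩⟩

theorem of_iso {H : SimpleGraph W} {G : SimpleGraph V} (f : H ≃g G) : H.IsMinorOf G :=
  of_hom f.toHom f.injective

theorem exists_injective {H : SimpleGraph W} {G : SimpleGraph V} (h : H.IsMinorOf G) :
    ∃ f : W → V, Function.Injective f := by
  obtain ⟨β, hc, hd, -⟩ := h
  choose f hf using fun x => (Set.nonempty_coe_sort.1 (hc x).nonempty)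
  refine ⟨f, fun x y hxy => by_contra fun hne => ?_⟩
  exact Set.disjoint_left.1 (hd x y hne) (hf x) (hxy ▸ hf y)

theorem card_le [Finite V] {H : SimpleGraph W} {G : SimpleGraph V} (h : H.IsMinorOf G) :
    Nat.card W ≤ Nat.card V :=
  let ⟨f, hf⟩ := h.exists_injective
  Nat.card_le_card_of_injective f hf

/-- A minor with as many vertices as the graph is a spanning subgraph. -/
theorem exists_bijective_hom [Finite V] {H : SimpleGraph W} {G : SimpleGraph V}
    (h : H.IsMinorOf G) (hcard : Nat.card V ≤ Nat.card W) :
    ∃ f : H →g G, Function.Bijective f := by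
  obtain ⟨β, hc, hd, ha⟩ := h
  choose f hf using fun x => (Set.nonempty_coe_sort.1 (hc x).nonempty)
  have hinj : Function.Injective f := fun x y hxy => by_contra fun hne =>
    Set.disjoint_left.1 (hd x y hne) (hf x) (hxy ▸ hf y)
  have hbij : Function.Bijective f := by
    have := Finite.of_injective f hinj
    have := Fintype.ofFinite V
    have := Fintype.ofFinite W
    rw [Fintype.bijective_iff_injective_and_card]
    refine ⟨hinj, ?_⟩
    rw [← Nat.card_eq_fintype_card, ← Nat.card_eq_fintype_card]
    exact le_antisymm (Nat.card_le_card_of_injective f hinj) hcard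
  -- The representatives exhaust the vertices, so each branch set is a singleton.
  have hsing : ∀ x, ∀ a ∈ β x, a = f x := by
    intro x a hax
    obtain ⟨y, rfl⟩ := hbij.2 a
    by_contra hne
    exact Set.disjoint_left.1 (hd y x (fun e => hne (e ▸ rfl))) (hf y) hax
  refine ⟨⟨f, fun {x y} hxy => ?_⟩, hbij⟩
  obtain ⟨a, hax, b, hby, hab⟩ := ha x y hxy
  rwa [← hsing x a hax, ← hsing y b hby]

/-- The bijective homomorphisms in both directions compose to a permutation `σ` of finite order. Its
power of exponent `orderOf σ - 1` undoes it and preserves adjacency, so adjacency is also reflected.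
-/
theorem antisymm [Finite V] {H : SimpleGraph W} {G : SimpleGraph V}
    (h₁ : H.IsMinorOf G) (h₂ : G.IsMinorOf H) : Nonempty (H ≃g G) := by
  have : Finite W := let ⟨f, hf⟩ := h₁.exists_injective; Finite.of_injective f hf
  obtain ⟨f, hf⟩ := h₁.exists_bijective_hom h₂.card_le
  obtain ⟨g, hg⟩ := h₂.exists_bijective_hom h₁.card_le
  let e := Equiv.ofBijective f hf
  let σ : Equiv.Perm W := e.trans (Equiv.ofBijective g hg)
  have hpow : ∀ n x y, H.Adj x y → H.Adj ((σ ^ n) x) ((σ ^ n) y) := by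
    intro n
    induction n with
    | zero => intro x y h; simpa using h
    | succ n ih =>
      intro x y h
      rw [pow_succ, Equiv.Perm.mul_apply, Equiv.Perm.mul_apply]
      exact ih _ _ (g.map_rel (f.map_rel h))
  refine ⟨⟨e, fun {x y} => ⟨fun h => ?_, fun h => f.map_rel h⟩⟩⟩
  have h' : H.Adj (σ x) (σ y) := g.map_rel h
  have h3 := hpow (orderOf σ - 1) _ _ h'
  rw [← Equiv.Perm.mul_apply, ← Equiv.Perm.mul_apply, ← pow_succ,
    Nat.sub_add_cancel (orderOf_pos σ), pow_orderOf_eq_one] at h3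
  exact h3

end IsMinorOf

/-! ### `K₄`-models and vertices of degree two -/

/-- Deleting a vertex whose neighbours form a clique does not disconnect a set. -/
theorem connected_induce_diff_singleton {G : SimpleGraph V} {s : Set V} {v u : V}
    (hs : (G.induce s).Connected) (hu : u ∈ s) (huv : u ≠ v)
    (hcl : ∀ a ∈ s, ∀ b ∈ s, G.Adj v a → G.Adj v b → a ≠ b → G.Adj a b) :
    (G.induce (s \ {v})).Connected := by
  classical
  by_cases hv : v ∈ s
  swap
  · rwa [Set.sdiff_singleton_eq_self hv]
  obtain ⟨⟨w, hw⟩, hvw⟩ : ∃ w, (G.induce s).Adj ⟨v, hv⟩ w := by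
    have : Nontrivial s := ⟨⟨u, hu⟩, ⟨v, hv⟩, by simpa [Subtype.ext_iff] using huv⟩
    exact hs.preconnected.exists_adj_of_nontrivial _
  have hvw : G.Adj v w := hvw
  -- A retraction sending `v` to one of its neighbours; the clique condition makes it map each edge
  -- to an edge or a point.
  let φ : s → (s \ {v} : Set V) := fun a =>
    if h : a.1 = v then ⟨w, hw, hvw.ne'⟩ else ⟨a, a.2, h⟩
  have hφ : ∀ a b : s, (G.induce s).Adj a b → (G.induce (s \ {v})).Reachable (φ a) (φ b) := by
    rintro ⟨a, ha⟩ ⟨b, hb⟩ hab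
    have hab : G.Adj a b := hab
    by_cases h1 : a = v
    · subst h1
      by_cases h3 : w = b
      · subst h3; simp [φ, hab.ne']
      · refine Adj.reachable ?_
        simpa [φ, hab.ne'] using hcl w hw b hb hvw hab h3
    · by_cases h2 : b = v
      · subst h2
        by_cases h3 : a = w
        · subst h3; simp [φ, hab.ne]
        · refine Adj.reachable ?_
          simpa [φ, hab.ne] using hcl a ha w hw hab.symm hvw h3
      · refine Adj.reachable ?_
        simpa [φ, h1, h2] using hab
  have hφ' : ∀ a b : s, (G.induce s).Reachable a b →
      (G.induce (s \ {v})).Reachable (φ a) (φ b) := by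
    rintro a b ⟨p⟩
    induction p with
    | nil => exact Reachable.refl _
    | cons h p ih => exact (hφ _ _ h).trans ih
  rw [connected_iff]
  refine ⟨?_, ⟨⟨u, hu, huv⟩⟩⟩
  rintro ⟨a, ha, hav⟩ ⟨b, hb, hbv⟩
  have hav' : a ≠ v := hav
  have hbv' : b ≠ v := hbv
  simpa [φ, hav', hbv'] using hφ' ⟨a, ha⟩ ⟨b, hb⟩ (hs.preconnected _ _)

/-- `S` contains the branch sets of a `K₄`-model. -/
def HasK4ModelIn (G : SimpleGraph V) (S : Set V) : Prop :=
  ∃ β : Fin 4 → Set V,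
    (∀ x, (G.induce (β x)).Connected) ∧
    (∀ x y, x ≠ y → Disjoint (β x) (β y)) ∧
    (∀ x y, x ≠ y → ∃ a ∈ β x, ∃ b ∈ β y, G.Adj a b) ∧ ∀ x, β x ⊆ S

/-- In a `K₄`-model, a branch set containing a vertex of degree at most two has another element. -/
theorem exists_ne_mem_of_k4_model {G : SimpleGraph V} {S : Set V} {β : Fin 4 → Set V}
    (hd : ∀ x y, x ≠ y → Disjoint (β x) (β y))
    (ha : ∀ x y, x ≠ y → ∃ a ∈ β x, ∃ b ∈ β y, G.Adj a b) (hS : ∀ x, β x ⊆ S)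
    {v a b : V} (hv : ∀ w ∈ S, G.Adj v w → w = a ∨ w = b) (x : Fin 4) :
    ∃ u ∈ β x, u ≠ v := by
  by_contra! h
  have hn : ∀ y, y ≠ x → ∃ c ∈ β y, G.Adj v c := by
    intro y hy
    obtain ⟨c, hc, d, hd, hcd⟩ := ha x y hy.symm
    rw [h c hc] at hcd
    exact ⟨d, hd, hcd⟩
  have hab : ∀ y, y ≠ x → a ∈ β y ∨ b ∈ β y := by
    intro y hy
    obtain ⟨c, hc, hvc⟩ := hn y hy
    rcases hv c (hS y hc) hvc with rfl | rfl
    · exact Or.inl hc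
    · exact Or.inr hc
  have hdis : ∀ y z, y ≠ z → ∀ c, c ∈ β y → c ∉ β z := fun y z hyz c h1 =>
    Set.disjoint_left.1 (hd y z hyz) h1
  obtain ⟨y, z, t, hy, hz, ht, hyz, hyt, hzt⟩ :
      ∃ y z t : Fin 4, y ≠ x ∧ z ≠ x ∧ t ≠ x ∧ y ≠ z ∧ y ≠ t ∧ z ≠ t :=
    (by decide : ∀ x : Fin 4, ∃ y z t : Fin 4, y ≠ x ∧ z ≠ x ∧ t ≠ x ∧ y ≠ z ∧ y ≠ t ∧ z ≠ t) x
  have h1 := hdis y z hyz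
  have h2 := hdis y t hyt
  have h3 := hdis z t hzt
  rcases hab y hy with h | h <;> rcases hab z hz with h' | h' <;> rcases hab t ht with h'' | h'' <;>
    first | exact h1 _ h h' | exact h2 _ h h'' | exact h3 _ h' h''

/-- The branch set of `v` also contains a neighbour `w` of `v`. Whatever used `v` can use `w`
instead, because the two possible neighbours of `v` are adjacent. -/
theorem HasK4ModelIn.diff_singleton {G : SimpleGraph V} {S : Set V} (h : G.HasK4ModelIn S)
    {v a b : V} (hv : ∀ w ∈ S, G.Adj v w → w = a ∨ w = b) (hab : G.Adj a b) :
    G.HasK4ModelIn (S \ {v}) := by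
  obtain ⟨β, hc, hd, ha, hS⟩ := h
  have hcl : ∀ c ∈ S, ∀ d ∈ S, G.Adj v c → G.Adj v d → c ≠ d → G.Adj c d := by
    intro c hc d hd h1 h2 hne
    rcases hv c hc h1 with rfl | rfl <;> rcases hv d hd h2 with rfl | rfl
    · exact absurd rfl hne
    · exact hab
    · exact hab.symm
    · exact absurd rfl hne
  have hne := exists_ne_mem_of_k4_model hd ha hS hv
  have hnb : ∀ x, v ∈ β x → ∃ w ∈ β x, G.Adj v w := by
    intro x hx
    obtain ⟨u, hu, huv⟩ := hne x
    have : Nontrivial (β x) := ⟨⟨u, hu⟩, ⟨v, hx⟩, by simpa [Subtype.ext_iff] using huv⟩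
    obtain ⟨w, hw⟩ := (hc x).preconnected.exists_adj_of_nontrivial ⟨v, hx⟩
    exact ⟨w, w.2, hw⟩
  refine ⟨fun x => β x \ {v}, fun x => ?_, fun x y hxy => ?_, fun x y hxy => ?_, fun x => ?_⟩
  · obtain ⟨u, hu, huv⟩ := hne x
    exact connected_induce_diff_singleton (hc x) hu huv
      fun c hc d hd => hcl c (hS x hc) d (hS x hd)
  · exact (hd x y hxy).mono Set.sdiff_subset Set.sdiff_subset
  · obtain ⟨c, hc, d, hd', hcd⟩ := ha x y hxy
    have hdis := Set.disjoint_left.1 (hd x y hxy)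
    by_cases h1 : c = v
    · subst h1
      obtain ⟨w, hw, hvw⟩ := hnb x hc
      refine ⟨w, ⟨hw, hvw.ne'⟩, d, ⟨hd', hcd.ne'⟩, ?_⟩
      exact hcl w (hS x hw) d (hS y hd') hvw hcd (fun e => hdis hw (e ▸ hd'))
    · by_cases h2 : d = v
      · subst h2
        obtain ⟨w, hw, hvw⟩ := hnb y hd'
        refine ⟨c, ⟨hc, hcd.ne⟩, w, ⟨hw, hvw.ne'⟩, ?_⟩
        exact hcl c (hS x hc) w (hS y hw) hcd.symm hvw (fun e => hdis hc (e ▸ hw))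
      · exact ⟨c, ⟨hc, h1⟩, d, ⟨hd', h2⟩, hcd⟩
  · exact Set.sdiff_subset_sdiff_left (hS x)

/-- Each branch set has an element other than `v`, which requires four of them; here the neighbours
of `v` need not be adjacent. -/
theorem HasK4ModelIn.four_le_card [Finite V] {G : SimpleGraph V} {S : Set V}
    (h : G.HasK4ModelIn S) {v a b : V} (hv : ∀ w ∈ S, G.Adj v w → w = a ∨ w = b) :
    4 ≤ (S \ {v}).ncard := by
  obtain ⟨β, -, hd, ha, hS⟩ := h
  choose f hf hfv using exists_ne_mem_of_k4_model hd ha hS hv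
  have hinj : Function.Injective f := fun x y hxy => by_contra fun hne =>
    Set.disjoint_left.1 (hd x y hne) (hf x) (hxy ▸ hf y)
  have : (Set.range f).ncard = 4 := by
    rw [← Nat.card_coe_set_eq, Nat.card_range_of_injective hinj]; simp
  rw [← this]
  refine Set.ncard_le_ncard ?_
  rintro _ ⟨x, rfl⟩
  exact ⟨hS x (hf x), hfv x⟩

theorem IsMinorOf.hasK4ModelIn_univ {G : SimpleGraph V}
    (h : (⊤ : SimpleGraph (Fin 4)).IsMinorOf G) : G.HasK4ModelIn Set.univ := by
  obtain ⟨β, hc, hd, ha⟩ := h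
  exact ⟨β, hc, hd, fun x y hxy => ha x y hxy, fun x => Set.subset_univ _⟩

/-! ### Biconnected graphs without a hub -/

/-- A Hamiltonian cycle given as an enumeration of the vertices witnesses biconnectedness. -/
theorem isBiconnected_of_walk [Nontrivial V] {G : SimpleGraph V} {a : V} {c : G.Walk a a}
    (hc : c.IsCycle) (h : ∀ v, v ∈ c.support) : G.IsBiconnected :=
  ⟨inferInstance, fun x y _ => ⟨a, c, hc, h x, h y⟩⟩

theorem not_isAcyclic_of_triangle {G : SimpleGraph V} {a b c : V} (hab : G.Adj a b)
    (hbc : G.Adj b c) (hca : G.Adj c a) : ¬ G.IsAcyclic := by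
  intro h
  refine h (.cons hab (.cons hbc (.cons hca .nil))) ?_
  rw [Walk.cons_isCycle_iff]
  simp [hab.ne, hab.ne', hbc.ne, hca.ne, hca.ne']

/-- `G` is biconnected, and no vertex meets all its cycles. -/
def IsBiconnectedWithoutHub (G : SimpleGraph V) : Prop :=
  G.IsBiconnected ∧ ∀ v, ¬ (G.induce {v}ᶜ).IsAcyclic

theorem IsBiconnected.of_iso {G : SimpleGraph V} {H : SimpleGraph W} (e : G ≃g H)
    (h : G.IsBiconnected) : H.IsBiconnected := by
  obtain ⟨hn, hc⟩ := h
  refine ⟨e.symm.toEquiv.nontrivial, fun x y hxy => ?_⟩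
  obtain ⟨a, c, hcyc, h1, h2⟩ := hc (e.symm x) (e.symm y) (by simpa using hxy)
  refine ⟨_, c.map e.toHom, hcyc.map e.injective, ?_, ?_⟩
  · rw [Walk.support_map, List.mem_map]
    exact ⟨_, h1, e.apply_symm_apply x⟩
  · rw [Walk.support_map, List.mem_map]
    exact ⟨_, h2, e.apply_symm_apply y⟩

theorem IsBiconnectedWithoutHub.of_iso {G : SimpleGraph V} {H : SimpleGraph W} (e : G ≃g H)
    (h : G.IsBiconnectedWithoutHub) : H.IsBiconnectedWithoutHub := by
  refine ⟨h.1.of_iso e, fun v hv => h.2 (e.symm v) ?_⟩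
  let φ : G.induce {e.symm v}ᶜ →g H.induce {v}ᶜ :=
    { toFun := fun a => ⟨e a.1, fun h => a.2 (by
        exact (e.toEquiv.symm_apply_eq.2 (Set.mem_singleton_iff.1 h).symm).symm)⟩
      map_rel' := fun {a b} hab => e.map_rel_iff.2 hab }
  exact hv.comap φ fun a b hab => Subtype.ext (e.injective (congrArg Subtype.val hab))

theorem isBiconnectedWithoutHub_of_triangles [Nontrivial V] {G : SimpleGraph V} {a : V}
    {c : G.Walk a a} (hc : c.IsCycle) (h : ∀ v, v ∈ c.support)
    (ht : ∀ v, ∃ x y z, x ≠ v ∧ y ≠ v ∧ z ≠ v ∧ G.Adj x y ∧ G.Adj y z ∧ G.Adj z x) :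
    G.IsBiconnectedWithoutHub := by
  refine ⟨isBiconnected_of_walk hc h, fun v => ?_⟩
  obtain ⟨x, y, z, hx, hy, hz, hxy, hyz, hzx⟩ := ht v
  exact not_isAcyclic_of_triangle (G := G.induce {v}ᶜ) (a := ⟨x, hx⟩) (b := ⟨y, hy⟩)
    (c := ⟨z, hz⟩) hxy hyz hzx

end SimpleGraph

namespace FinGraph

open SimpleGraph

/-! ### The three obstructions: no hub, and pairwise incomparable -/

instance : DecidableRel threeSun.Adj := by unfold threeSun; infer_instance

instance : DecidableRel twoJoinedTriangles.Adj := by unfold twoJoinedTriangles; infer_instance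

theorem threeSun_isBiconnectedWithoutHub : threeSun.IsBiconnectedWithoutHub := by
  refine isBiconnectedWithoutHub_of_triangles (a := 0) (c :=
    .cons (v := 3) (by decide) (.cons (v := 1) (by decide) (.cons (v := 4) (by decide)
    (.cons (v := 2) (by decide) (.cons (v := 5) (by decide) (.cons (by decide) .nil)))))) ?_ ?_ ?_
  · rw [Walk.cons_isCycle_iff]; simp
  · simp only [Walk.support_cons, Walk.support_nil]; decide
  · intro v
    fin_cases v
    · exact ⟨1, 2, 4, by decide⟩
    · exact ⟨0, 2, 5, by decide⟩
    · exact ⟨0, 1, 3, by decide⟩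
    all_goals exact ⟨0, 1, 2, by decide⟩

theorem twoJoinedTriangles_isBiconnectedWithoutHub :
    twoJoinedTriangles.IsBiconnectedWithoutHub := by
  refine isBiconnectedWithoutHub_of_triangles (a := 0) (c :=
    .cons (v := 2) (by decide) (.cons (v := 1) (by decide) (.cons (v := 4) (by decide)
    (.cons (v := 5) (by decide) (.cons (v := 3) (by decide) (.cons (by decide) .nil)))))) ?_ ?_ ?_
  · rw [Walk.cons_isCycle_iff]; simp
  · simp only [Walk.support_cons, Walk.support_nil]; decide
  · intro v
    fin_cases v
    iterate 3 exact ⟨3, 4, 5, by decide⟩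
    all_goals exact ⟨0, 1, 2, by decide⟩

theorem completeGraph_four_isBiconnectedWithoutHub :
    (⊤ : SimpleGraph (Fin 4)).IsBiconnectedWithoutHub := by
  refine isBiconnectedWithoutHub_of_triangles (a := 0) (c :=
    .cons (v := 1) (by decide) (.cons (v := 2) (by decide) (.cons (v := 3) (by decide)
    (.cons (by decide) .nil)))) ?_ ?_ ?_
  · rw [Walk.cons_isCycle_iff]; simp
  · simp only [Walk.support_cons, Walk.support_nil]; decide
  · intro v
    fin_cases v
    · exact ⟨1, 2, 3, by decide⟩
    · exact ⟨0, 2, 3, by decide⟩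
    · exact ⟨0, 1, 3, by decide⟩
    · exact ⟨0, 1, 2, by decide⟩

/-- Stripping `5` and `4` and then discounting `3` leaves only three vertices for four branch sets.
-/
theorem not_k4_isMinorOf_threeSun : ¬ (⊤ : SimpleGraph (Fin 4)).IsMinorOf threeSun := by
  intro h
  have h5 := h.hasK4ModelIn_univ.diff_singleton (v := 5) (a := 2) (b := 0) (by simp; decide)
    (by decide)
  have h4 := h5.diff_singleton (v := 4) (a := 1) (b := 2) (by simp; decide) (by decide)
  have h3 := h4.four_le_card (v := 3) (a := 0) (b := 1) (by simp; decide)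
  have : ((Set.univ \ {5}) \ {4}) \ {3} = (({0, 1, 2} : Finset (Fin 6)) : Set (Fin 6)) := by
    ext x; fin_cases x <;> simp
  rw [this, Set.ncard_coe_finset] at h3
  revert h3; decide

theorem not_k4_isMinorOf_twoJoinedTriangles :
    ¬ (⊤ : SimpleGraph (Fin 4)).IsMinorOf twoJoinedTriangles := by
  intro h
  have h5 := h.hasK4ModelIn_univ.diff_singleton (v := 5) (a := 3) (b := 4) (by simp; decide)
    (by decide)
  have h2 := h5.diff_singleton (v := 2) (a := 0) (b := 1) (by simp; decide) (by decide)
  -- The two remaining neighbours `1`, `3` of `0` are not adjacent, so `0` cannot be stripped;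
  -- counting suffices.
  have h0 := h2.four_le_card (v := 0) (a := 1) (b := 3) (by simp; decide)
  have : ((Set.univ \ {5}) \ {2}) \ {0} = (({1, 3, 4} : Finset (Fin 6)) : Set (Fin 6)) := by
    ext x; fin_cases x <;> simp
  rw [this, Set.ncard_coe_finset] at h0
  revert h0; decide

/-- With six vertices on both sides the minor would be a spanning subgraph. In the sun the edge `01`
lies in two triangles, but no edge of the other graph does. -/
theorem not_threeSun_isMinorOf_twoJoinedTriangles : ¬ threeSun.IsMinorOf twoJoinedTriangles := by
  intro h
  obtain ⟨f, hf⟩ := h.exists_bijective_hom le_rfl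
  have key : ∀ a b c, twoJoinedTriangles.Adj a b → twoJoinedTriangles.Adj b c →
      twoJoinedTriangles.Adj c a → ∀ d, twoJoinedTriangles.Adj d a → twoJoinedTriangles.Adj d b →
      d ≠ c → False := by decide
  exact key (f 0) (f 1) (f 2) (f.map_rel (by decide)) (f.map_rel (by decide))
    (f.map_rel (by decide)) (f 3) (f.map_rel (by decide)) (f.map_rel (by decide))
    (hf.1.ne (by decide))

-- Any two triangles of the sun share a vertex, so it has no two disjoint triangles. The conditions
-- are interleaved with the quantifiers so that `decide` discards partial embeddings early.
set_option synthInstance.maxHeartbeats 400000 in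
set_option synthInstance.maxSize 2000 in
theorem not_twoJoinedTriangles_isMinorOf_threeSun : ¬ twoJoinedTriangles.IsMinorOf threeSun := by
  intro h
  obtain ⟨f, hf⟩ := h.exists_bijective_hom le_rfl
  have key : ∀ a b c, threeSun.Adj a b → threeSun.Adj b c → threeSun.Adj c a →
      ∀ d, threeSun.Adj a d → d ≠ b → d ≠ c → ∀ e, threeSun.Adj b e → threeSun.Adj d e →
      e ≠ a → e ≠ c → ∀ k, threeSun.Adj e k → threeSun.Adj k d → k ≠ a → k ≠ b → k ≠ c →
      False := by decide
  exact key (f 0) (f 1) (f 2) (f.map_rel (by decide)) (f.map_rel (by decide))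
    (f.map_rel (by decide)) (f 3) (f.map_rel (by decide)) (hf.1.ne (by decide))
    (hf.1.ne (by decide)) (f 4) (f.map_rel (by decide)) (f.map_rel (by decide))
    (hf.1.ne (by decide)) (hf.1.ne (by decide)) (f 5) (f.map_rel (by decide))
    (f.map_rel (by decide)) (hf.1.ne (by decide)) (hf.1.ne (by decide)) (hf.1.ne (by decide))

end FinGraph

/-! ### Cycles and blocks -/

namespace SimpleGraph

variable {V W X : Type*}

theorem IsBiconnected.not_isAcyclic {G : SimpleGraph V} (h : G.IsBiconnected) :
    ¬ G.IsAcyclic := by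
  obtain ⟨⟨x, y, hxy⟩, hc⟩ := h
  obtain ⟨a, c, hcyc, -⟩ := hc x y hxy
  exact fun hG => hG c hcyc

theorem Walk.IsCycle.isBiconnected_toSubgraph {G : SimpleGraph V} {a : V} {c : G.Walk a a}
    (hc : c.IsCycle) : c.toSubgraph.coe.IsBiconnected := by
  have hmap := c.map_mapToSubgraph_hom
  have hcyc : c.mapToSubgraph.IsCycle := by
    refine Walk.IsCycle.of_map (f := c.toSubgraph.hom) ?_
    rwa [hmap]
  have : Nontrivial c.toSubgraph.verts := by
    have := hc.three_le_length
    refine ⟨⟨a, c.start_mem_verts_toSubgraph⟩, ⟨c.snd, ?_⟩, ?_⟩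
    · exact c.mem_verts_toSubgraph.2 (c.getVert_mem_support 1)
    · simpa [Subtype.ext_iff] using (c.adj_snd hc.not_nil).ne
  refine isBiconnected_of_walk hcyc ?_
  rintro ⟨v, hv⟩
  have hs : c.mapToSubgraph.support.map c.toSubgraph.hom = c.support :=
    (Walk.support_map _ _).symm.trans (congrArg Walk.support hmap)
  have hv' := hv
  rw [Walk.mem_verts_toSubgraph, ← hs, List.mem_map] at hv'
  obtain ⟨w, hw, rfl⟩ := hv'
  exact hw

theorem IsBiconnected.exists_le_block [Finite V] {G : SimpleGraph V} {H : G.Subgraph}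
    (h : H.coe.IsBiconnected) : ∃ B ∈ G.blocks, H ≤ B ∧ B.coe.IsBiconnected := by
  obtain ⟨B, hHB, hB⟩ := (Set.toFinite {H : G.Subgraph | H.coe.IsBiconnected}).exists_le_maximal h
  exact ⟨B, Or.inr (Or.inr hB), hHB, hB.prop⟩

theorem IsBiconnected.isBlockGraph {G : SimpleGraph V} (h : G.IsBiconnected) :
    G.IsBlockGraph :=
  isBlockGraph_of_top_mem
    (Or.inr (Or.inr ⟨h.of_iso Subgraph.topIso.symm, fun _ _ _ => le_top⟩))

/-- A block is biconnected or has at most two vertices. -/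
theorem isBiconnected_or_card_le_of_mem_blocks {G : SimpleGraph V} {B : G.Subgraph}
    (hB : B ∈ G.blocks) : B.coe.IsBiconnected ∨ Nat.card B.verts ≤ 2 := by
  rcases hB with ⟨v, -, rfl⟩ | ⟨x, y, h, -, rfl⟩ | hB
  · right; simp
  · right
    rw [Nat.card_coe_set_eq, subgraphOfAdj_verts]
    exact (Set.ncard_insert_le _ _).trans (by simp)
  · exact Or.inl hB.prop

/-- Every edge is contained in a block. -/
theorem exists_block_of_adj [Finite V] {G : SimpleGraph V} {x y : V} (h : G.Adj x y) :
    ∃ B ∈ G.blocks, B.Adj x y := by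
  by_cases hb : G.IsBridge s(x, y)
  · exact ⟨G.subgraphOfAdj h, Or.inr (Or.inl ⟨x, y, h, hb, rfl⟩), by simp⟩
  · rw [isBridge_iff_forall_cycle_notMem h] at hb
    push Not at hb
    obtain ⟨a, c, hc, he⟩ := hb
    obtain ⟨B, hB, hle, -⟩ := hc.isBiconnected_toSubgraph.exists_le_block
    exact ⟨B, hB, hle.2 (Walk.adj_toSubgraph_iff_mem_edges.2 he)⟩

theorem exists_biconnected_block_of_not_isAcyclic [Finite V] {G : SimpleGraph V}
    (h : ¬ G.IsAcyclic) : ∃ B ∈ G.blocks, B.coe.IsBiconnected := by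
  simp only [IsAcyclic, not_forall, not_not] at h
  obtain ⟨a, c, hc⟩ := h
  obtain ⟨B, hB, -, hB'⟩ := hc.isBiconnected_toSubgraph.exists_le_block
  exact ⟨B, hB, hB'⟩

/-- A cycle has an edge that avoids a given vertex. -/
theorem exists_adj_ne_of_not_isAcyclic {G : SimpleGraph V} (h : ¬ G.IsAcyclic) (v : V) :
    ∃ x y, G.Adj x y ∧ x ≠ v ∧ y ≠ v := by
  by_contra! hv
  refine h fun a c hc => ?_
  have h3 := hc.three_le_length
  have hn : ∀ i j, i < c.length → j < c.length → i ≠ j → c.getVert i ≠ c.getVert j := by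
    intro i j hi hj hij e
    exact hij (hc.getVert_injOn' (by simp; omega) (by simp; omega) e)
  have h01 := c.adj_getVert_succ (i := 0) (by omega)
  have h12 := c.adj_getVert_succ (i := 1) (by omega)
  -- If every edge meets `v`, then `v` has to occupy positions 1 and 3 of the cycle.
  have h1 : c.getVert 1 = v := by
    by_contra h1
    have h0 : c.getVert 0 = v := by
      by_contra h0
      exact h1 (hv _ _ h01 h0)
    have h2 := hv _ _ h12 h1
    exact hn 0 2 (by omega) (by omega) (by omega) (h0.trans h2.symm)
  have h2 : c.getVert 2 ≠ v := h1 ▸ hn 2 1 (by omega) (by omega) (by omega)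
  have h23 := c.adj_getVert_succ (i := 2) (by omega)
  have h3' := hv _ _ h23 h2
  -- In a triangle position 3 is position 0 again; in a longer cycle it is a new vertex.
  by_cases h4 : c.length = 3
  · have : c.getVert 3 = a := by rw [← h4]; simp
    have h0 : c.getVert 0 = a := by simp
    exact hn 0 1 (by omega) (by omega) (by omega) (by rw [h0, h1, ← this, h3'])
  · exact hn 3 1 (by omega) (by omega) (by omega) (h3'.trans h1.symm)

end SimpleGraph

/-! ### Bounds on the block elimination distance to edgeless graphs -/

namespace FinGraph

open SimpleGraph

theorem mem_edgeless_iff {G : FinGraph.{u}} : G ∈ edgeless ↔ ∀ x y, ¬ G.graph.Adj x y := by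
  rw [edgeless, Set.mem_ofPred_eq, eq_bot_iff_forall_not_adj]

theorem bed_of_mem {𝒢 : Set FinGraph.{u}} {G : FinGraph.{u}} (h : G ∈ 𝒢) : G.bed 𝒢 = 0 := by
  rw [bed]; simp [h]

theorem bed_of_isBlockGraph {𝒢 : Set FinGraph.{u}} {G : FinGraph.{u}} (h : G ∉ 𝒢)
    (hG : G.graph.IsBlockGraph) : G.bed 𝒢 = 1 + ⨅ v : G.V, (G.deleteVertex v).bed 𝒢 := by
  rw [bed]; simp [h, hG]

theorem bed_of_not_isBlockGraph {𝒢 : Set FinGraph.{u}} {G : FinGraph.{u}} (h : G ∉ 𝒢)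
    (hG : ¬ G.graph.IsBlockGraph) :
    G.bed 𝒢 = ⨆ B : {B : G.graph.Subgraph // B ∈ G.graph.blocks}, (G.ofSubgraph B.1).bed 𝒢 := by
  rw [bed]; simp [h, hG]

theorem bed_ofSubgraph_le {𝒢 : Set FinGraph.{u}} {G : FinGraph.{u}} (h : G ∉ 𝒢)
    (hG : ¬ G.graph.IsBlockGraph) {B : G.graph.Subgraph} (hB : B ∈ G.graph.blocks) :
    (G.ofSubgraph B).bed 𝒢 ≤ G.bed 𝒢 := by
  rw [bed_of_not_isBlockGraph h hG]
  exact le_iSup (fun B : {B : G.graph.Subgraph // B ∈ G.graph.blocks} =>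
    (G.ofSubgraph B.1).bed 𝒢) ⟨B, hB⟩

theorem not_mem_edgeless_of_not_isAcyclic {G : FinGraph.{u}} (h : ¬ G.graph.IsAcyclic) :
    G ∉ edgeless := by
  intro hG
  have hG : G.graph = ⊥ := hG
  exact h (hG ▸ isAcyclic_bot)

theorem one_le_bed {G : FinGraph.{u}} (h : G ∉ edgeless) : 1 ≤ G.bed edgeless := by
  induction hn : Nat.card G.V using Nat.strong_induction_on generalizing G with
  | _ n ih =>
    by_cases hG : G.graph.IsBlockGraph
    · rw [bed_of_isBlockGraph h hG]; exact le_self_add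
    · have h' := h
      rw [mem_edgeless_iff] at h'
      push Not at h'
      obtain ⟨x, y, hxy⟩ := h'
      obtain ⟨B, hB, hBxy⟩ := exists_block_of_adj hxy
      refine le_trans ?_ (bed_ofSubgraph_le h hG hB)
      refine ih _ (hn ▸ card_ofSubgraph_lt hG hB) ?_ rfl
      rw [mem_edgeless_iff]
      exact fun hn => hn ⟨x, hBxy.fst_mem⟩ ⟨y, hBxy.snd_mem⟩ hBxy

/-- Deleting any vertex of a graph with a cycle leaves an edge. A graph that is not a block-graph
passes the bound on from a smaller block that contains a cycle. -/
theorem two_le_bed {G : FinGraph.{u}} (h : ¬ G.graph.IsAcyclic) : 2 ≤ G.bed edgeless := by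
  induction hn : Nat.card G.V using Nat.strong_induction_on generalizing G with
  | _ n ih =>
    have hne := not_mem_edgeless_of_not_isAcyclic h
    by_cases hG : G.graph.IsBlockGraph
    · rw [bed_of_isBlockGraph hne hG, ← one_add_one_eq_two]
      refine add_le_add_right (le_iInf fun v => one_le_bed ?_) _
      rw [mem_edgeless_iff]
      obtain ⟨x, y, hxy, hx, hy⟩ := exists_adj_ne_of_not_isAcyclic h v
      exact fun hn => hn ⟨x, hx⟩ ⟨y, hy⟩ hxy
    · obtain ⟨B, hB, hbic⟩ := exists_biconnected_block_of_not_isAcyclic h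
      exact (ih _ (hn ▸ card_ofSubgraph_lt hG hB) hbic.not_isAcyclic rfl).trans
        (bed_ofSubgraph_le hne hG hB)

theorem three_le_bed {G : FinGraph.{u}} (h : G.graph.IsBiconnectedWithoutHub) :
    3 ≤ G.bed edgeless := by
  rw [bed_of_isBlockGraph (not_mem_edgeless_of_not_isAcyclic h.1.not_isAcyclic) h.1.isBlockGraph,
    show (3 : ℕ∞) = 1 + 2 by norm_num]
  exact add_le_add_right (le_iInf fun v => two_le_bed (h.2 v)) _

theorem mem_edgeless_of_card_le_one {G : FinGraph.{u}} (h : Nat.card G.V ≤ 1) :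
    G ∈ edgeless := by
  rw [mem_edgeless_iff]
  intro x y hxy
  have := (Finite.card_le_one_iff_subsingleton).1 h
  exact hxy.ne (Subsingleton.elim x y)

theorem bed_le_one_of_card_le_two {G : FinGraph.{u}} (h : Nat.card G.V ≤ 2) :
    G.bed edgeless ≤ 1 := by
  by_cases hG : G ∈ edgeless
  · simp [bed_of_mem hG]
  by_cases hb : G.graph.IsBlockGraph
  · rw [bed_of_isBlockGraph hG hb]
    have hG' := hG
    rw [mem_edgeless_iff] at hG'
    push Not at hG'
    obtain ⟨x, -⟩ := hG'
    have : (G.deleteVertex x).bed edgeless = 0 := by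
      refine bed_of_mem (mem_edgeless_of_card_le_one ?_)
      have := G.card_deleteVertex_lt x
      omega
    calc 1 + ⨅ v : G.V, (G.deleteVertex v).bed edgeless ≤ 1 + 0 :=
          add_le_add_right (this ▸ iInf_le _ x) _
      _ = 1 := add_zero _
  · rw [bed_of_not_isBlockGraph hG hb]
    refine iSup_le fun B => ?_
    rw [bed_of_mem (mem_edgeless_of_card_le_one ?_)]
    · exact zero_le
    · have := card_ofSubgraph_lt hb B.2
      omega

/-- A block-graph is biconnected or has at most two vertices. -/
theorem isBiconnected_or_card_le_of_isBlockGraph {G : FinGraph.{u}}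
    (hG : G.graph.IsBlockGraph) : G.graph.IsBiconnected ∨ Nat.card G.V ≤ 2 := by
  have htop : ⊤ ∈ G.graph.blocks := by
    rw [IsBlockGraph] at hG
    rw [hG]; rfl
  rcases isBiconnected_or_card_le_of_mem_blocks htop with h | h
  · exact Or.inl (h.of_iso Subgraph.topIso)
  · right
    rwa [Subgraph.verts_top, Nat.card_coe_set_eq, Set.ncard_univ] at h

/-- A biconnected block would contain a cycle, so only blocks with at most two vertices occur. -/
theorem bed_le_one {G : FinGraph.{u}} (h : G.graph.IsAcyclic) : G.bed edgeless ≤ 1 := by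
  by_cases hG : G ∈ edgeless
  · simp [bed_of_mem hG]
  by_cases hb : G.graph.IsBlockGraph
  · rcases isBiconnected_or_card_le_of_isBlockGraph hb with h' | h'
    · exact absurd h h'.not_isAcyclic
    · exact bed_le_one_of_card_le_two h'
  · rw [bed_of_not_isBlockGraph hG hb]
    refine iSup_le fun B => ?_
    rcases isBiconnected_or_card_le_of_mem_blocks B.2 with h' | h'
    · exact absurd (h.subgraph B.1) h'.not_isAcyclic
    · exact bed_le_one_of_card_le_two h'

theorem mem_bedLE_one_iff {G : FinGraph.{u}} :
    G ∈ bedLE edgeless.{u} 1 ↔ G.graph.IsAcyclic := by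
  refine ⟨fun h => ?_, fun h => bed_le_one h⟩
  by_contra hG
  have h : G.bed edgeless ≤ 1 := h
  exact absurd ((two_le_bed hG).trans h) (by decide)

theorem bed_le_two_of_isBlockGraph {G : FinGraph.{u}} (hG : G.graph.IsBlockGraph)
    (h : ¬ G.graph.IsBiconnectedWithoutHub) : G.bed edgeless ≤ 2 := by
  rcases isBiconnected_or_card_le_of_isBlockGraph hG with hb | hc
  · have : ∃ v, (G.graph.induce {v}ᶜ).IsAcyclic := by
      by_contra! hv
      exact h ⟨hb, hv⟩
    obtain ⟨v, hv⟩ := this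
    rw [bed_of_isBlockGraph (not_mem_edgeless_of_not_isAcyclic hb.not_isAcyclic) hG,
      ← one_add_one_eq_two]
    exact add_le_add_right ((iInf_le _ v).trans (bed_le_one hv)) _
  · exact (bed_le_one_of_card_le_two hc).trans (by decide)

/-- The graphs outside the second class are those with a bad biconnected minor. -/
theorem exists_isMinorOf_of_not_mem_bedLE_two {G : FinGraph.{u}}
    (h : G ∉ bedLE edgeless.{u} 2) :
    ∃ Y : FinGraph.{u}, Y.graph.IsMinorOf G.graph ∧ Y.graph.IsBiconnectedWithoutHub := by
  have h : ¬ G.bed edgeless ≤ 2 := h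
  by_cases hG : G.graph.IsBlockGraph
  · refine ⟨G, IsMinorOf.of_iso (RelIso.refl _), ?_⟩
    by_contra hb
    exact h (bed_le_two_of_isBlockGraph hG hb)
  · by_contra! hY
    have hne : G ∉ edgeless := fun hne => h (by simp [bed_of_mem hne])
    refine h ?_
    rw [bed_of_not_isBlockGraph hne hG]
    refine iSup_le fun B => ?_
    rcases isBiconnected_or_card_le_of_mem_blocks B.2 with hb | hc
    · exact bed_le_two_of_isBlockGraph (G := G.ofSubgraph B.1) hb.isBlockGraph
        (hY (G.ofSubgraph B.1) (IsMinorOf.of_hom B.1.hom Subgraph.hom_injective))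
    · exact (bed_le_one_of_card_le_two (G := G.ofSubgraph B.1) hc).trans (by decide)

end FinGraph

namespace SimpleGraph

variable {V W X : Type*}

/-! ### Deletion on a fixed vertex type, and sides -/

/-- The graph `G` with the vertex `x` isolated. -/
abbrev del (G : SimpleGraph V) (x : V) : SimpleGraph V := G.deleteIncidenceSet x

theorem del_adj {G : SimpleGraph V} {x a b : V} :
    (G.del x).Adj a b ↔ G.Adj a b ∧ a ≠ x ∧ b ≠ x := deleteIncidenceSet_adj

theorem del_mono {G H : SimpleGraph V} (h : G ≤ H) (x : V) : G.del x ≤ H.del x := fun _ _ hab =>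
  del_adj.2 ⟨h (del_adj.1 hab).1, (del_adj.1 hab).2⟩

theorem del_comm (G : SimpleGraph V) (x y : V) : (G.del x).del y = (G.del y).del x := by
  ext a b
  simp only [del_adj]
  tauto

theorem mem_of_reachable_of_closed {G : SimpleGraph V} {s : Set V} {a b : V}
    (h : G.Reachable a b) (ha : a ∈ s) (hcl : ∀ c ∈ s, ∀ d, G.Adj c d → d ∈ s) : b ∈ s := by
  obtain ⟨p⟩ := h
  induction p with
  | nil => exact ha
  | cons h p ih => exact ih (hcl _ ha _ h)

theorem eq_of_del_reachable {G : SimpleGraph V} {x a : V} (h : (G.del x).Reachable x a) :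
    a = x :=
  mem_of_reachable_of_closed (s := {x}) h rfl fun _ hc _ hd =>
    absurd hc (del_adj.1 hd).2.1

theorem ne_of_del_reachable {G : SimpleGraph V} {x a b : V} (h : (G.del x).Reachable a b)
    (ha : a ≠ x) : b ≠ x := by
  rintro rfl
  exact ha (eq_of_del_reachable h.symm)

/-- A walk that reaches `y` has to enter `y`. -/
theorem Reachable.exists_del_reachable_adj {G : SimpleGraph V} {a y : V} (h : G.Reachable a y)
    (hay : a ≠ y) : ∃ b, (G.del y).Reachable a b ∧ G.Adj b y := by
  obtain ⟨p⟩ := h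
  induction p with
  | nil => exact absurd rfl hay
  | @cons a b y h p ih =>
    by_cases hb : b = y
    · subst hb; exact ⟨a, Reachable.refl _, h⟩
    · obtain ⟨c, hc, hcy⟩ := ih hb
      exact ⟨c, (Adj.reachable (del_adj.2 ⟨h, hay, hb⟩)).trans hc, hcy⟩

/-- A walk to one of two vertices reaches one of them before the other. -/
theorem Reachable.del_or_del {G : SimpleGraph V} {a x y : V} (h : G.Reachable a x)
    (hxy : x ≠ y) : (G.del y).Reachable a x ∨ (G.del x).Reachable a y := by
  obtain ⟨p⟩ := h
  induction p with
  | nil => exact Or.inl (Reachable.refl _)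
  | @cons a b x h p ih =>
    by_cases hay : a = y
    · subst hay; exact Or.inr (Reachable.refl _)
    by_cases hax : a = x
    · subst hax; exact Or.inl (Reachable.refl _)
    by_cases hby : b = y
    · subst hby; exact Or.inr (Adj.reachable (del_adj.2 ⟨h, hax, hxy.symm⟩))
    by_cases hbx : b = x
    · subst hbx; exact Or.inl (Adj.reachable (del_adj.2 ⟨h, hay, hxy⟩))
    rcases ih hxy with h' | h'
    · exact Or.inl ((Adj.reachable (del_adj.2 ⟨h, hay, hby⟩)).trans h')
    · exact Or.inr ((Adj.reachable (del_adj.2 ⟨h, hax, hbx⟩)).trans h')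

theorem connected_induce_reachable {G H : SimpleGraph V} (h : H ≤ G) (a : V) :
    (G.induce {b | H.Reachable a b}).Connected :=
  connected_induce_mono h (connected_induce_of_closed (x := a) (Reachable.refl _)
    (fun _ hb => hb.symm) fun _ hb _ _ hbc => hb.trans hbc.reachable)

/-- The vertices that `x` separates from `y` in `T`, together with `x`. -/
def side (T : SimpleGraph V) (x y : V) : Set V :=
  {a | T.Reachable a x ∧ ¬ (T.del x).Reachable a y}

section Side

variable {T : SimpleGraph V} {x y : V}

theorem self_mem_side (hxy : x ≠ y) : x ∈ T.side x y :=
  ⟨Reachable.refl _, fun h => hxy (eq_of_del_reachable h).symm⟩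

theorem mem_side_of_adj (hxy : x ≠ y) {a b : V} (ha : a ∈ T.side x y) (hax : a ≠ x)
    (hab : T.Adj a b) : b ∈ T.side x y := by
  by_cases hbx : b = x
  · subst hbx; exact self_mem_side hxy
  · exact ⟨hab.symm.reachable.trans ha.1, fun h =>
      ha.2 ((Adj.reachable (del_adj.2 ⟨hab, hax, hbx⟩)).trans h)⟩

theorem mem_side_of_del_reachable {a b : V} (ha : a ∈ T.side x y)
    (hab : (T.del x).Reachable a b) : b ∈ T.side x y :=
  ⟨(hab.symm.mono (deleteIncidenceSet_le _ _)).trans ha.1, fun h => ha.2 (hab.trans h)⟩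

theorem connected_induce_side (hxy : x ≠ y) : (T.induce (T.side x y)).Connected :=
  connected_induce_of_closed (self_mem_side hxy) (fun _ ha => ha.1)
    fun _ ha hax _ hab => mem_side_of_adj hxy ha hax hab

/-- A walk from a common vertex would reach one of `x`, `y` before the other, which excludes its
start from one of the sides. -/
theorem disjoint_side_side (hxy : x ≠ y) : Disjoint (T.side x y) (T.side y x) :=
  Set.disjoint_left.2 fun _ h1 h2 => (h1.1.del_or_del hxy).elim h2.2 h1.2

/-- What is on neither side: its component meets no side and is attached to both ends. -/
theorem exists_middle_component {n : V} (hn : T.Reachable n x) (hxy : T.Reachable x y)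
    (h1 : n ∉ T.side x y) (h2 : n ∉ T.side y x) (hne : x ≠ y) :
    ∃ K : Set V, n ∈ K ∧ (T.induce K).Connected ∧ (∀ a ∈ K, T.Reachable a x) ∧
      Disjoint K (T.side x y) ∧ Disjoint K (T.side y x) ∧
      (∃ a ∈ K, T.Adj x a) ∧ ∃ b ∈ K, T.Adj b y := by
  have hnx : n ≠ x := fun h => h1 (by rw [h]; exact self_mem_side hne)
  have hny : n ≠ y := fun h => h2 (by rw [h]; exact self_mem_side hne.symm)
  have h1' : (T.del x).Reachable n y := by
    by_contra h; exact h1 ⟨hn, h⟩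
  have h2' : (T.del y).Reachable n x := by
    by_contra h; exact h2 ⟨hn.trans hxy, h⟩
  refine ⟨{b | ((T.del x).del y).Reachable n b}, Reachable.refl _, connected_induce_reachable
    ((deleteIncidenceSet_le _ _).trans (deleteIncidenceSet_le _ _)) n, fun a ha => ?_, ?_, ?_,
    ?_, ?_⟩
  · exact (ha.symm.mono ((deleteIncidenceSet_le _ _).trans (deleteIncidenceSet_le _ _))).trans hn
  · exact Set.disjoint_left.2 fun a ha hs =>
      hs.2 ((ha.symm.mono (deleteIncidenceSet_le _ _)).trans h1')
  · refine Set.disjoint_left.2 fun a ha hs => hs.2 (Reachable.trans (Reachable.symm ?_) h2')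
    have ha : ((T.del x).del y).Reachable n a := ha
    rw [del_comm] at ha
    exact ha.mono (deleteIncidenceSet_le _ _)
  · obtain ⟨b, hb, hbx⟩ := h2'.exists_del_reachable_adj hnx
    rw [del_comm] at hb
    exact ⟨b, hb, (del_adj.1 hbx).1.symm⟩
  · obtain ⟨b, hb, hby⟩ := h1'.exists_del_reachable_adj hny
    exact ⟨b, hb, (del_adj.1 hby).1⟩

/-- The vertex just before `y` on a walk from `x` qualifies; non-adjacency ensures that it is not
`x`. -/
theorem exists_not_mem_side (hxy : T.Reachable x y) (hne : x ≠ y) (hadj : ¬ T.Adj x y) :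
    ∃ n, T.Reachable n x ∧ n ∉ T.side x y ∧ n ∉ T.side y x := by
  obtain ⟨b, hb, hby⟩ := hxy.exists_del_reachable_adj hne
  have hbx : b ≠ x := by rintro rfl; exact hadj hby
  exact ⟨b, hb.symm.mono (deleteIncidenceSet_le _ _),
    fun h => h.2 (Adj.reachable (del_adj.2 ⟨hby, hbx, hne.symm⟩)), fun h => h.2 hb.symm⟩

/-- A component of `T - x` can be entered only through `x`, so the other vertices reach `x` without
it. -/
theorem connected_induce_side_diff (hxy : x ≠ y) {p : V} (hpx : p ≠ x) :
    (T.induce (T.side x y \ {a | (T.del x).Reachable p a})).Connected := by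
  refine connected_induce_of_closed (x := x)
    ⟨self_mem_side hxy, fun h => hpx (eq_of_del_reachable (Reachable.symm h))⟩
    (fun a ha => ha.1.1) fun a ha hax b hab => ⟨mem_side_of_adj hxy ha.1 hax hab, fun hb => ?_⟩
  have hb : (T.del x).Reachable p b := hb
  exact ha.2 (hb.trans (Adj.reachable
    (del_adj.2 ⟨hab.symm, ne_of_del_reachable hb hpx, hax⟩)))

end Side

/-! ### Touching sets, links and attachments -/

/-- Two sets of vertices are joined by an edge. -/
def Touch (G : SimpleGraph V) (A B : Set V) : Prop :=
  ∃ a ∈ A, ∃ b ∈ B, G.Adj a b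

theorem Touch.symm {G : SimpleGraph V} {A B : Set V} (h : G.Touch A B) : G.Touch B A :=
  let ⟨a, ha, b, hb, hab⟩ := h
  ⟨b, hb, a, ha, hab.symm⟩

theorem Touch.mono {G : SimpleGraph V} {A B A' B' : Set V} (h : G.Touch A B) (hA : A ⊆ A')
    (hB : B ⊆ B') : G.Touch A' B' :=
  let ⟨a, ha, b, hb, hab⟩ := h
  ⟨a, hA ha, b, hB hb, hab⟩

/-- A connected set splits between two of its elements into two connected sets that touch. -/
theorem exists_split {G D : SimpleGraph V} (hDG : D ≤ G) {p q : V} (h : D.Reachable p q)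
    (hpq : p ≠ q) : ∃ α β : Set V, p ∈ α ∧ q ∈ β ∧ (G.induce α).Connected ∧
      (G.induce β).Connected ∧ Disjoint α β ∧ G.Touch α β ∧ α ∪ β = {a | D.Reachable p a} := by
  refine ⟨{a | (D.del q).Reachable p a}, D.side q p, Reachable.refl _, self_mem_side hpq.symm,
    connected_induce_reachable ((deleteIncidenceSet_le _ _).trans hDG) p,
    connected_induce_mono hDG (connected_induce_side hpq.symm),
    Set.disjoint_left.2 fun a ha hb => hb.2 (Reachable.symm ha), ?_, ?_⟩
  · obtain ⟨b, hb, hbq⟩ := h.exists_del_reachable_adj hpq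
    exact ⟨b, hb, q, self_mem_side hpq.symm, hDG hbq⟩
  · ext a
    constructor
    · rintro (ha | ha)
      · exact Reachable.mono (deleteIncidenceSet_le _ _) ha
      · exact h.trans ha.1.symm
    · intro ha
      by_cases h' : (D.del q).Reachable p a
      · exact Or.inl h'
      · exact Or.inr ⟨(Reachable.symm ha).trans h, fun h'' => h' h''.symm⟩

/-- `L` is empty and `x`, `y` are adjacent, or `L` is connected and touches both `x` and `y`. -/
def IsLink (G : SimpleGraph V) (x y : V) (L : Set V) : Prop :=
  (L = ∅ ∧ G.Adj x y) ∨ ((G.induce L).Connected ∧ G.Touch {x} L ∧ G.Touch L {y})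

theorem IsLink.connected_insert {G : SimpleGraph V} {x y : V} {L : Set V} (h : G.IsLink x y L) :
    (G.induce (insert x L)).Connected := by
  rcases h with ⟨rfl, -⟩ | ⟨hc, ⟨a, ha, b, hb, hab⟩, -⟩
  · rw [insert_empty_eq]; exact connected_induce_singleton G x
  · exact connected_induce_union (connected_induce_singleton G x).preconnected hc.preconnected
      ha hb hab

theorem IsLink.touch_insert {G : SimpleGraph V} {x y : V} {L : Set V} (h : G.IsLink x y L) :
    G.Touch (insert x L) {y} := by
  rcases h with ⟨rfl, h⟩ | ⟨-, -, h⟩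
  · exact ⟨x, Set.mem_insert _ _, y, rfl, h⟩
  · exact h.mono (Set.subset_insert _ _) subset_rfl

theorem IsLink.of_nonempty {G : SimpleGraph V} {x y : V} {L : Set V} (h : G.IsLink x y L)
    (hL : L.Nonempty) : (G.induce L).Connected ∧ G.Touch {x} L ∧ G.Touch L {y} := by
  rcases h with ⟨rfl, -⟩ | h
  · exact absurd hL Set.not_nonempty_empty
  · exact h

theorem IsLink.symm {G : SimpleGraph V} {x y : V} {L : Set V} (h : G.IsLink x y L) :
    G.IsLink y x L := by
  rcases h with ⟨rfl, h⟩ | ⟨hc, h1, h2⟩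
  · exact Or.inl ⟨rfl, h.symm⟩
  · exact Or.inr ⟨hc, h2.symm, h1.symm⟩

theorem IsLink.connected_union {G : SimpleGraph V} {x y : V} {A L : Set V} (h : G.IsLink x y L)
    (hA : (G.induce A).Connected) (hx : x ∈ A) : (G.induce (A ∪ L)).Connected := by
  have := induce_union_connected hA.preconnected h.connected_insert.preconnected
    ⟨x, hx, Set.mem_insert _ _⟩
  rwa [Set.union_insert, Set.insert_eq_of_mem (Set.mem_union_left _ hx)] at this

theorem IsLink.touch_union {G : SimpleGraph V} {x y : V} {A B L : Set V} (h : G.IsLink x y L)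
    (hx : x ∈ A) (hy : y ∈ B) : G.Touch (A ∪ L) B :=
  h.touch_insert.mono (Set.insert_subset (Or.inl hx) Set.subset_union_right)
    (Set.singleton_subset_iff.2 hy)

theorem isMinorOf_of_lt {n : ℕ} {H : SimpleGraph (Fin n)} {G : SimpleGraph V}
    (β : Fin n → Set V) (hc : ∀ i, (G.induce (β i)).Connected)
    (hd : ∀ i j, i < j → Disjoint (β i) (β j))
    (ha : ∀ i j, i < j → H.Adj i j → G.Touch (β i) (β j)) : H.IsMinorOf G := by
  refine ⟨β, hc, fun i j hij => ?_, fun i j hij => ?_⟩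
  · rcases lt_or_gt_of_ne hij with h | h
    · exact hd i j h
    · exact (hd j i h).symm
  · rcases lt_or_gt_of_ne hij.ne with h | h
    · exact ha i j h hij
    · exact (ha j i h hij.symm).symm

/-- A connected set `S` containing `x` that contains a triangle-like pair `α`, `β` seen by `v`
and attached to the part `A` of `x`. -/
def HasDoubleAttachment (G : SimpleGraph V) (v x : V) (S : Set V) : Prop :=
  ∃ A α β : Set V, x ∈ A ∧ A ⊆ S ∧ α ⊆ S ∧ β ⊆ S ∧
    (G.induce A).Connected ∧ (G.induce α).Connected ∧ (G.induce β).Connected ∧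
    Disjoint A α ∧ Disjoint A β ∧ Disjoint α β ∧
    G.Touch α β ∧ G.Touch {v} α ∧ G.Touch {v} β ∧ G.Touch α A

/-- A set `S` containing `x` with touching parts `A ∋ x` and `α` that are both seen by `v`. -/
def HasSplitAttachment (G : SimpleGraph V) (v x : V) (S : Set V) : Prop :=
  ∃ A α : Set V, x ∈ A ∧ A ⊆ S ∧ α ⊆ S ∧ (G.induce A).Connected ∧ (G.induce α).Connected ∧
    Disjoint A α ∧ G.Touch {v} A ∧ G.Touch {v} α ∧ G.Touch α A

/-- The component of `T - x` containing `p` and `q` is split between them, and the rest of the side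
serves as `A`. The half containing a neighbour of `x` takes the role of `α`. -/
theorem HasDoubleAttachment.of_reachable {G T : SimpleGraph V} (hT : T ≤ G)
    {x y v p q : V} (hxy : x ≠ y) (hp : p ∈ T.side x y) (hpq : p ≠ q)
    (hreach : (T.del x).Reachable p q) (hvp : G.Adj v p) (hvq : G.Adj v q) :
    G.HasDoubleAttachment v x (T.side x y) := by
  have hpx : p ≠ x := by
    rintro rfl
    exact hpq (eq_of_del_reachable hreach).symm
  have hcA := connected_induce_mono hT (connected_induce_side_diff hxy hpx)
  have hxA : x ∈ T.side x y \ {a | (T.del x).Reachable p a} :=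
    ⟨self_mem_side hxy, fun h => hpx (eq_of_del_reachable (Reachable.symm h))⟩
  obtain ⟨c, hc, hcx⟩ := hp.1.exists_del_reachable_adj hpx
  have hsub : {a | (T.del x).Reachable p a} ⊆ T.side x y := fun a ha =>
    mem_side_of_del_reachable hp ha
  obtain ⟨α, β, hpα, hqβ, hα, hβ, hαβ, htouch, hun⟩ :=
    exists_split ((deleteIncidenceSet_le _ _).trans hT) hreach hpq
  have hcU : c ∈ α ∪ β := hun ▸ hc
  have hαs : α ⊆ {a | (T.del x).Reachable p a} := hun ▸ Set.subset_union_left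
  have hβs : β ⊆ {a | (T.del x).Reachable p a} := hun ▸ Set.subset_union_right
  have hdα : Disjoint (T.side x y \ {a | (T.del x).Reachable p a}) α :=
    Set.disjoint_sdiff_left.mono_right hαs
  have hdβ : Disjoint (T.side x y \ {a | (T.del x).Reachable p a}) β :=
    Set.disjoint_sdiff_left.mono_right hβs
  rcases hcU with hc' | hc'
  · exact ⟨_, α, β, hxA, Set.sdiff_subset, hαs.trans hsub, hβs.trans hsub, hcA, hα, hβ, hdα, hdβ,
      hαβ, htouch, ⟨v, rfl, p, hpα, hvp⟩, ⟨v, rfl, q, hqβ, hvq⟩, ⟨c, hc', x, hxA, hT hcx⟩⟩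
  · exact ⟨_, β, α, hxA, Set.sdiff_subset, hβs.trans hsub, hαs.trans hsub, hcA, hβ, hα, hdβ, hdα,
      hαβ.symm, htouch.symm, ⟨v, rfl, q, hqβ, hvq⟩, ⟨v, rfl, p, hpα, hvp⟩,
      ⟨c, hc', x, hxA, hT hcx⟩⟩

theorem hasDoubleAttachment_or_hasSplitAttachment {G T : SimpleGraph V} (hT : T ≤ G)
    {x y v p q : V} (hxy : x ≠ y) (hp : p ∈ T.side x y) (hq : q ∈ T.side x y) (hpq : p ≠ q)
    (hvp : G.Adj v p) (hvq : G.Adj v q) :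
    G.HasDoubleAttachment v x (T.side x y) ∨ G.HasSplitAttachment v x (T.side x y) := by
  wlog hpx : p ≠ x generalizing p q
  · have hpx : p = x := not_not.1 hpx
    exact this hq hp hpq.symm hvq hvp (hpx ▸ hpq.symm)
  by_cases hreach : (T.del x).Reachable p q
  · exact Or.inl (.of_reachable hT hxy hp hpq hreach hvp hvq)
  -- Now `p` and `q` lie in different pieces: the component of `p` is `α`, and the rest, containing
  -- `x` and `q`, is `A`.
  right
  have hxA : x ∈ T.side x y \ {a | (T.del x).Reachable p a} :=
    ⟨self_mem_side hxy, fun h => hpx (eq_of_del_reachable (Reachable.symm h))⟩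
  obtain ⟨c, hc, hcx⟩ := hp.1.exists_del_reachable_adj hpx
  exact ⟨_, {a | (T.del x).Reachable p a}, hxA, Set.sdiff_subset,
    fun a ha => mem_side_of_del_reachable hp ha,
    connected_induce_mono hT (connected_induce_side_diff hxy hpx),
    connected_induce_reachable ((deleteIncidenceSet_le _ _).trans hT) p,
    Set.disjoint_sdiff_left, ⟨v, rfl, q, ⟨hq, hreach⟩, hvq⟩,
    ⟨v, rfl, p, Reachable.refl _, hvp⟩, ⟨c, hc, x, hxA, hT hcx⟩⟩

/-! ### Assembling the three minors -/

theorem k4_isMinorOf_of_links {G : SimpleGraph V} {v x y : V} {S S' M R : Set V}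
    (hS : (G.induce S).Connected) (hx : x ∈ S) (hS' : (G.induce S').Connected) (hy : y ∈ S')
    (hM : G.IsLink x y M) (hMne : M.Nonempty) (hR : G.IsLink x y R)
    (hvS : v ∉ S) (hvS' : v ∉ S') (hvM : v ∉ M) (hvR : v ∉ R)
    (hSS' : Disjoint S S') (hMS : Disjoint M S) (hMS' : Disjoint M S')
    (hRS' : Disjoint R S') (hMR : Disjoint M R)
    (h1 : G.Touch {v} S) (h2 : G.Touch {v} S') (h3 : G.Touch {v} M) :
    (⊤ : SimpleGraph (Fin 4)).IsMinorOf G := by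
  obtain ⟨hMc, hxM, hMy⟩ := hM.of_nonempty hMne
  have hx' : ({x} : Set V) ⊆ S ∪ R := Set.singleton_subset_iff.2 (Or.inl hx)
  refine isMinorOf_of_lt ![{v}, S ∪ R, S', M] ?_ ?_ ?_
  · intro i
    fin_cases i
    · exact connected_induce_singleton G v
    · exact hR.connected_union hS hx
    · exact hS'
    · exact hMc
  · rw [Set.disjoint_left] at *
    intro i j hij
    rw [Set.disjoint_left]
    fin_cases i <;> fin_cases j <;> first | exact absurd hij (by decide) | skip
    all_goals simp; grind
  · intro i j hij _
    fin_cases i <;> fin_cases j <;> first | exact absurd hij (by decide) | skip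
    · exact h1.mono subset_rfl Set.subset_union_left
    · exact h2
    · exact h3
    · exact hR.touch_union hx hy
    · exact hxM.mono hx' subset_rfl
    · exact (hMy.mono subset_rfl (Set.singleton_subset_iff.2 hy)).symm

theorem twoJoinedTriangles_isMinorOf_of_links {G : SimpleGraph V} {v x y : V}
    {S S' M R : Set V} (hS : G.HasDoubleAttachment v x S)
    (hS' : (G.induce S').Connected) (hy : y ∈ S')
    (hM : G.IsLink x y M) (hMne : M.Nonempty) (hR : G.IsLink x y R)
    (hvS : v ∉ S) (hvS' : v ∉ S') (hvM : v ∉ M) (hvR : v ∉ R)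
    (hSS' : Disjoint S S') (hMS : Disjoint M S) (hMS' : Disjoint M S')
    (hRS : Disjoint R S) (hRS' : Disjoint R S') (hMR : Disjoint M R)
    (h2 : G.Touch {v} S') :
    FinGraph.twoJoinedTriangles.IsMinorOf G := by
  obtain ⟨hMc, hxM, hMy⟩ := hM.of_nonempty hMne
  obtain ⟨A, α, β, hxA, hAS, hαS, hβS, hA, hα, hβ, hAα, hAβ, hαβ, t1, t2, t3, t4⟩ := hS
  have hx' : ({x} : Set V) ⊆ A ∪ R := Set.singleton_subset_iff.2 (Or.inl hxA)
  -- The triangles are `v`, `α`, `β` and `S'`, `A ∪ R`, `M`, joined by `v`–`S'` and `α`–`A`.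
  refine isMinorOf_of_lt ![{v}, α, β, S', A ∪ R, M] ?_ ?_ ?_
  · intro i
    fin_cases i
    · exact connected_induce_singleton G v
    · exact hα
    · exact hβ
    · exact hS'
    · exact hR.connected_union hA hxA
    · exact hMc
  · rw [Set.disjoint_left] at *
    intro i j hij
    rw [Set.disjoint_left]
    fin_cases i <;> fin_cases j <;> first | exact absurd hij (by decide) | skip
    all_goals simp; grind
  · intro i j hij hadj
    fin_cases i <;> fin_cases j <;>
      first | exact absurd hij (by decide) | exact absurd hadj (by decide) | skip
    · exact t2
    · exact t3
    · exact h2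
    · exact t1
    · exact t4.mono subset_rfl Set.subset_union_left
    · exact (hR.touch_union hxA hy).symm
    · exact (hMy.mono subset_rfl (Set.singleton_subset_iff.2 hy)).symm
    · exact hxM.mono hx' subset_rfl

theorem threeSun_isMinorOf_of_links {G : SimpleGraph V} {v x y : V}
    {S S' M R : Set V} (hS : G.HasSplitAttachment v x S) (hS' : G.HasSplitAttachment v y S')
    (hM : G.IsLink x y M) (hMne : M.Nonempty) (hR : G.IsLink x y R)
    (hvS : v ∉ S) (hvS' : v ∉ S') (hvM : v ∉ M) (hvR : v ∉ R)
    (hSS' : Disjoint S S') (hMS : Disjoint M S) (hMS' : Disjoint M S')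
    (hRS : Disjoint R S) (hRS' : Disjoint R S') (hMR : Disjoint M R) :
    FinGraph.threeSun.IsMinorOf G := by
  obtain ⟨hMc, hxM, hMy⟩ := hM.of_nonempty hMne
  obtain ⟨A, α, hxA, hAS, hαS, hA, hα, hAα, t1, t2, t3⟩ := hS
  obtain ⟨B, β, hyB, hBS, hβS, hB, hβ, hBβ, s1, s2, s3⟩ := hS'
  have hx' : ({x} : Set V) ⊆ A ∪ R := Set.singleton_subset_iff.2 (Or.inl hxA)
  -- The central triangle is `v`, `A ∪ R`, `B`; the sets `α`, `M`, `β` sit on its edges.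
  refine isMinorOf_of_lt ![{v}, A ∪ R, B, α, M, β] ?_ ?_ ?_
  · intro i
    fin_cases i
    · exact connected_induce_singleton G v
    · exact hR.connected_union hA hxA
    · exact hB
    · exact hα
    · exact hMc
    · exact hβ
  · rw [Set.disjoint_left] at *
    intro i j hij
    rw [Set.disjoint_left]
    fin_cases i <;> fin_cases j <;> first | exact absurd hij (by decide) | skip
    all_goals simp; grind
  · intro i j hij hadj
    fin_cases i <;> fin_cases j <;>
      first | exact absurd hij (by decide) | exact absurd hadj (by decide) | skip
    · exact t1.mono subset_rfl Set.subset_union_left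
    · exact s1
    · exact t2
    · exact s2
    · exact hR.touch_union hxA hyB
    · exact t3.symm.mono Set.subset_union_left subset_rfl
    · exact hxM.mono hx' subset_rfl
    · exact (hMy.mono subset_rfl (Set.singleton_subset_iff.2 hyB)).symm
    · exact s3.symm

/-- The union of a connected piece `T` and a link `L` outside it, seen from a vertex `v` in such a
way that none of `v`, `x`, `y` hits all cycles, contains one of the three obstructions. -/
theorem isMinorOf_of_side_links {G T : SimpleGraph V} (hT : T ≤ G) {x y v : V} {N L : Set V}
    (hne : x ≠ y) (hxy : T.Reachable x y)
    (hN : ∀ n ∈ N, G.Adj v n ∧ T.Reachable n x) (hv : ¬ T.Reachable v x)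
    (hNx : ∃ n ∈ N, n ∈ T.side x y) (hNy : ∃ n ∈ N, n ∈ T.side y x)
    (hL : G.IsLink x y L) (hLT : ∀ a ∈ L, ¬ T.Reachable a x) (hvL : v ∉ L)
    (hLne : L.Nonempty ∨ ¬ T.Adj x y)
    (hx : ∃ p ∈ N, ∃ q ∈ N, p ≠ q ∧ (T.del x).Reachable p q)
    (hy : ∃ p ∈ N, ∃ q ∈ N, p ≠ q ∧ (T.del y).Reachable p q) :
    (⊤ : SimpleGraph (Fin 4)).IsMinorOf G ∨ FinGraph.threeSun.IsMinorOf G ∨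
      FinGraph.twoJoinedTriangles.IsMinorOf G := by
  have hS := connected_induce_mono hT (connected_induce_side (T := T) hne)
  have hS' := connected_induce_mono hT (connected_induce_side (T := T) hne.symm)
  have hxS := self_mem_side (T := T) hne
  have hyS := self_mem_side (T := T) hne.symm
  have hSS' := disjoint_side_side (T := T) hne
  have hvS : v ∉ T.side x y := fun h => hv h.1
  have hvS' : v ∉ T.side y x := fun h => hv (h.1.trans hxy.symm)
  have hLS : Disjoint L (T.side x y) := Set.disjoint_left.2 fun a ha h => hLT a ha h.1
  have hLS' : Disjoint L (T.side y x) :=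
    Set.disjoint_left.2 fun a ha h => hLT a ha (h.1.trans hxy.symm)
  have htx : G.Touch {v} (T.side x y) :=
    let ⟨n, hn, hnS⟩ := hNx; ⟨v, rfl, n, hnS, (hN n hn).1⟩
  have hty : G.Touch {v} (T.side y x) :=
    let ⟨n, hn, hnS⟩ := hNy; ⟨v, rfl, n, hnS, (hN n hn).1⟩
  have hmid : ∀ n, T.Reachable n x → n ∉ T.side x y → n ∉ T.side y x →
      ∃ K : Set V, n ∈ K ∧ G.IsLink x y K ∧ Disjoint K (T.side x y) ∧ Disjoint K (T.side y x) ∧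
        Disjoint K L ∧ v ∉ K := by
    intro n hn h1 h2
    obtain ⟨K, hnK, hKc, hKr, hKS, hKS', ⟨a, ha, hxa⟩, b, hb, hby⟩ :=
      exists_middle_component hn hxy h1 h2 hne
    exact ⟨K, hnK, Or.inr ⟨connected_induce_mono hT hKc, ⟨x, rfl, a, ha, hT hxa⟩,
      ⟨b, hb, y, rfl, hT hby⟩⟩, hKS, hKS',
      Set.disjoint_left.2 fun a ha haL => hLT a haL (hKr a ha), fun h => hv (hKr v h)⟩
  by_cases hout : ∃ n ∈ N, n ∉ T.side x y ∧ n ∉ T.side y x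
  · obtain ⟨n, hnN, h1, h2⟩ := hout
    obtain ⟨K, hnK, hK, hKS, hKS', hKL, hvK⟩ := hmid n (hN n hnN).2 h1 h2
    exact Or.inl (k4_isMinorOf_of_links hS hxS hS' hyS hK ⟨n, hnK⟩ hL hvS hvS' hvK hvL hSS' hKS
      hKS' hLS' hKL htx hty ⟨v, rfl, n, hnK, (hN n hnN).1⟩)
  push Not at hout
  right
  -- Two disjoint links, one in `T` and one from the ear. If `x`, `y` are adjacent in `T`, the link
  -- in `T` is empty and the ear must supply the nonempty `M`.
  obtain ⟨M, R, hM, hMne, hR, hMS, hMS', hRS, hRS', hMR, hvM, hvR⟩ : ∃ M R : Set V,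
      G.IsLink x y M ∧ M.Nonempty ∧ G.IsLink x y R ∧ Disjoint M (T.side x y) ∧
      Disjoint M (T.side y x) ∧ Disjoint R (T.side x y) ∧ Disjoint R (T.side y x) ∧
      Disjoint M R ∧ v ∉ M ∧ v ∉ R := by
    by_cases hadj : T.Adj x y
    · exact ⟨L, ∅, hL, hLne.resolve_right (not_not.2 hadj), Or.inl ⟨rfl, hT hadj⟩, hLS, hLS',
        Set.empty_disjoint _, Set.empty_disjoint _, Set.disjoint_empty _, hvL,
        Set.notMem_empty v⟩
    · obtain ⟨n, hn, h1, h2⟩ := exists_not_mem_side hxy hne hadj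
      obtain ⟨K, hnK, hK, hKS, hKS', hKL, hvK⟩ := hmid n hn h1 h2
      exact ⟨K, L, hK, ⟨n, hnK⟩, hL, hKS, hKS', hLS, hLS', hKL, hvK, hvL⟩
  by_cases hdx : G.HasDoubleAttachment v x (T.side x y)
  · exact Or.inr (twoJoinedTriangles_isMinorOf_of_links hdx hS' hyS hM hMne hR hvS hvS' hvM hvR
      hSS' hMS hMS' hRS hRS' hMR hty)
  by_cases hdy : G.HasDoubleAttachment v y (T.side y x)
  · exact Or.inr (twoJoinedTriangles_isMinorOf_of_links hdy hS hxS hM.symm hMne hR.symm hvS' hvS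
      hvM hvR hSS'.symm hMS' hMS hRS' hRS hMR htx)
  left
  obtain ⟨p, hp, q, hq, hpq, hreach⟩ := hx
  obtain ⟨p', hp', q', hq', hpq', hreach'⟩ := hy
  -- A pair joined avoiding `x` cannot lie on the side of `x`, so it lies on the side of `y`, and
  -- conversely.
  have hpS : p ∉ T.side x y := fun h =>
    hdx (.of_reachable hT hne h hpq hreach (hN p hp).1 (hN q hq).1)
  have hqS : q ∉ T.side x y := fun h =>
    hdx (.of_reachable hT hne h hpq.symm hreach.symm (hN q hq).1 (hN p hp).1)
  have hpS' : p' ∉ T.side y x := fun h =>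
    hdy (.of_reachable hT hne.symm h hpq' hreach' (hN p' hp').1 (hN q' hq').1)
  have hqS' : q' ∉ T.side y x := fun h =>
    hdy (.of_reachable hT hne.symm h hpq'.symm hreach'.symm (hN q' hq').1 (hN p' hp').1)
  have hsx := (hasDoubleAttachment_or_hasSplitAttachment hT hne
    (by_contra fun h => hpS' (hout p' hp' h)) (by_contra fun h => hqS' (hout q' hq' h)) hpq'
    (hN p' hp').1 (hN q' hq').1).resolve_left hdx
  have hsy := (hasDoubleAttachment_or_hasSplitAttachment hT hne.symm (hout p hp hpS)
    (hout q hq hqS) hpq (hN p hp).1 (hN q hq).1).resolve_left hdy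
  exact threeSun_isMinorOf_of_links hsx hsy hM hMne hR hvS hvS' hvM hvR hSS' hMS hMS' hRS hRS' hMR

/-! ### Paths in cycles, cut vertices and ears -/

theorem Walk.del_reachable_of_mem {G : SimpleGraph V} {u w z : V} (p : G.Walk u w)
    (hz : z ∉ p.support) {a : V} (ha : a ∈ p.support) : (G.del z).Reachable u a := by
  induction p with
  | nil => rw [Walk.support_nil, List.mem_singleton] at ha; rw [ha]
  | @cons u c w h p ih =>
    rw [Walk.support_cons, List.mem_cons, not_or] at hz
    rw [Walk.support_cons, List.mem_cons] at ha
    rcases ha with rfl | ha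
    · exact Reachable.refl _
    · exact (Adj.reachable (del_adj.2
        ⟨h, Ne.symm hz.1, fun e => hz.2 (e ▸ p.start_mem_support)⟩)).trans (ih hz.2 ha)

/-- A cycle through `z` is a path between two distinct neighbours of `z`, avoiding `z`. -/
theorem Walk.IsCycle.exists_path_avoiding {G : SimpleGraph V} {a z : V} {c : G.Walk a a}
    (hc : c.IsCycle) (hz : z ∈ c.support) : ∃ (u w : V) (q : G.Walk u w), u ≠ w ∧ G.Adj z u ∧
      G.Adj z w ∧ z ∉ q.support ∧ ∀ b ∈ c.support, b ≠ z → b ∈ q.support := by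
  classical
  have hd := hc.rotate hz
  have hsup : ∀ b ∈ c.support, b ∈ (c.rotate z hz).support := by
    intro b hb
    by_cases hbz : b = z
    · subst hbz; simp
    · exact (Walk.mem_support_rotate_iff ..).2 hb
  generalize c.rotate z hz = d at hd hsup
  cases d with
  | nil => exact absurd rfl hd.ne_nil
  | @cons _ u _ h p =>
    rw [Walk.cons_isCycle_iff] at hd
    obtain ⟨hp, he⟩ := hd
    -- Reversal exposes the last edge of the cycle, which is stripped like the first; the two differ
    -- since a cycle repeats no edge.
    rw [← Walk.isPath_reverse_iff] at hp
    rw [← List.mem_reverse, ← Walk.edges_reverse] at he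
    have hsup' : ∀ b ∈ c.support, b ≠ z → b ∈ p.reverse.support := by
      intro b hb hbz
      have := hsup b hb
      rw [Walk.support_cons, List.mem_cons] at this
      rw [Walk.support_reverse, List.mem_reverse]
      exact this.resolve_left hbz
    generalize p.reverse = r at hp he hsup'
    cases r with
    | nil => exact absurd rfl h.ne
    | @cons _ w _ h' q =>
      rw [Walk.cons_isPath_iff] at hp
      refine ⟨w, u, q, ?_, h', h, hp.2, fun b hb hbz => ?_⟩
      · rintro rfl
        exact he (by simp)
      · have := hsup' b hb hbz
        rw [Walk.support_cons, List.mem_cons] at this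
        exact this.resolve_left hbz

theorem IsBiconnected.del_reachable {G : SimpleGraph V} (h : G.IsBiconnected) {z a b : V}
    (ha : a ≠ z) (hb : b ≠ z) : (G.del z).Reachable a b := by
  by_cases hab : a = b
  · subst hab; exact Reachable.refl _
  obtain ⟨s, c, hc, hac, hbc⟩ := h.2 a b hab
  by_cases hz : z ∈ c.support
  · obtain ⟨u, w, q, -, -, -, hzq, hq⟩ := hc.exists_path_avoiding hz
    exact (q.del_reachable_of_mem hzq (hq a hac ha)).symm.trans
      (q.del_reachable_of_mem hzq (hq b hbc hb))
  · exact (c.del_reachable_of_mem hz hac).symm.trans (c.del_reachable_of_mem hz hbc)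

theorem IsBiconnected.exists_adj {G : SimpleGraph V} (h : G.IsBiconnected) (a : V) :
    ∃ b, G.Adj a b := by
  classical
  have := h.1
  obtain ⟨b, hb⟩ := exists_ne a
  obtain ⟨s, c, hc, hac, -⟩ := h.2 a b hb.symm
  exact ⟨_, Walk.adj_snd (hc.rotate hac).not_nil⟩

/-- If `v` meets all the cycles of a graph with cycles, then two of its neighbours are joined
outside `v`. -/
theorem exists_reachable_neighbors {K : SimpleGraph V} {v : V} (hK : ¬ K.IsAcyclic)
    (hv : (K.del v).IsAcyclic) :
    ∃ p q, p ≠ q ∧ K.Adj v p ∧ K.Adj v q ∧ (K.del v).Reachable p q := by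
  simp only [IsAcyclic, not_forall, not_not] at hK
  obtain ⟨a, c, hc⟩ := hK
  by_cases hvc : v ∈ c.support
  · obtain ⟨u, w, q, hne, hu, hw, hvq, -⟩ := hc.exists_path_avoiding hvc
    exact ⟨u, w, hne, hu, hw, q.del_reachable_of_mem hvq q.end_mem_support⟩
  · have : ∀ e ∈ c.edges, e ∈ (K.del v).edgeSet := by
      intro e he
      induction e with
      | _ s t =>
        rw [mem_edgeSet, del_adj]
        exact ⟨c.adj_of_mem_edges he, fun h => hvc (h ▸ c.fst_mem_support_of_mem_edges he),
          fun h => hvc (h ▸ c.snd_mem_support_of_mem_edges he)⟩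
    exact absurd (hc.transfer this) (hv _)

theorem not_reachable_of_notMem_support {K : SimpleGraph V} {a b : V} (ha : a ∉ K.support)
    (hab : a ≠ b) : ¬ K.Reachable a b := fun h =>
  hab (mem_of_reachable_of_closed (s := {a}) h rfl fun _ hc d hd =>
    absurd ((K.mem_support).2 ⟨d, Set.mem_singleton_iff.1 hc ▸ hd⟩) ha).symm

/-- Attaching a pendant path preserves acyclicity. -/
theorem IsAcyclic.sup_pendant_path {G K : SimpleGraph V} {y w : V} (P : G.Walk y w)
    (hP : P.IsPath) (hK : K.IsAcyclic) (hd : ∀ a ∈ P.support, a ∈ K.support → a = y) :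
    (K ⊔ fromEdgeSet {e | e ∈ P.edges}).IsAcyclic := by
  induction P generalizing K with
  | nil => simpa using hK
  | @cons y c w h p ih =>
    rw [Walk.cons_isPath_iff] at hP
    -- The next path vertex is isolated in `K`, so the new edge joins two components and closes no
    -- cycle.
    have hcK : c ∉ K.support := fun hc => h.ne' (hd c (by simp) hc)
    have hK' : (K ⊔ edge y c).IsAcyclic :=
      hK.sup_edge_of_not_reachable fun hr =>
        not_reachable_of_notMem_support hcK h.ne' hr.symm
    have := ih hP.1 hK' ?_
    · refine this.anti ?_
      intro a b hab
      simp only [sup_adj, fromEdgeSet_adj, Walk.edges_cons, List.mem_cons, Set.mem_ofPred_eq,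
        edge_adj] at hab ⊢
      rcases hab with hab | ⟨hab | hab, hne⟩
      · exact Or.inl (Or.inl hab)
      · rw [Sym2.eq_iff] at hab
        exact Or.inl (Or.inr ⟨hab, hne⟩)
      · exact Or.inr ⟨hab, hne⟩
    · rintro a ha ⟨b, hb⟩
      have hb : (K ⊔ edge y c).Adj a b := hb
      rw [sup_adj, edge_adj] at hb
      rcases hb with hb | ⟨⟨rfl, rfl⟩ | ⟨rfl, rfl⟩, -⟩
      · have := hd a (by simp [ha]) ⟨b, hb⟩
        subst this
        exact absurd ha hP.2
      · exact absurd ha hP.2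
      · rfl

/-- No vertex separates two other non-isolated vertices. -/
def NoCut (H : SimpleGraph V) : Prop :=
  ∀ z a b, a ∈ H.support → b ∈ H.support → a ≠ z → b ≠ z → (H.del z).Reachable a b

/-- Every vertex of `T = H - v` that is an end of an ear has a neighbour of `v` on its side. -/
theorem NoCut.exists_adj_mem_side {H : SimpleGraph V} (hH : H.NoCut) {v x y : V}
    (hv : v ∈ H.support) (hx : x ∈ H.support) (hxv : x ≠ v) (hxy : x ≠ y)
    (hacyc : (H.del v).IsAcyclic) (hr : (H.del v).Reachable x y) :
    ∃ n ∈ (H.del v).side x y, H.Adj v n := by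
  by_contra! hn
  obtain ⟨z, hz, hzx⟩ := hr.symm.exists_del_reachable_adj hxy.symm
  have hzx' := del_adj.1 hzx
  have hvx : ¬ (H.del v).Reachable v x := fun h => hxv (eq_of_del_reachable h)
  -- Here `z` is the neighbour of `x` towards `y`. Without a neighbour of `v` in it, the side is
  -- closed in `H - z`, although `H - z` joins `x` to `v`.
  have hmem : v ∈ (H.del v).side x y := by
    refine mem_of_reachable_of_closed
      (hH z x v hx hv hzx'.1.ne' hzx'.2.1.symm) (self_mem_side hxy) fun a ha b hab => ?_
    rw [del_adj] at hab
    have hbv : b ≠ v := by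
      rintro rfl
      exact hn a ha hab.1.symm
    have hav : a ≠ v := by
      rintro rfl
      exact hvx ha.1
    have hab' : (H.del v).Adj a b := del_adj.2 ⟨hab.1, hav, hbv⟩
    by_cases hax : a = x
    swap
    · exact mem_side_of_adj hxy ha hax hab'
    subst hax
    refine ⟨hab'.symm.reachable, fun hb => ?_⟩
    -- A second edge from `x` towards `y` would close a cycle with `zx`, but edges of a forest are
    -- bridges.
    have hbr := isAcyclic_iff_forall_adj_isBridge.1 hacyc hab'
    rw [isBridge_iff] at hbr
    refine hbr (Reachable.trans (Adj.reachable ?_) ((hz.symm.trans hb.symm).mono ?_))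
    · rw [deleteEdges_adj]
      refine ⟨hzx.symm, fun h => ?_⟩
      rw [Set.mem_singleton_iff, Sym2.eq_iff] at h
      rcases h with ⟨-, h⟩ | ⟨h, -⟩
      · exact hab.2.2 h.symm
      · exact hab'.ne h
    · intro s t hst
      rw [del_adj] at hst
      rw [deleteEdges_adj]
      refine ⟨hst.1, fun h => ?_⟩
      rw [Set.mem_singleton_iff, Sym2.eq_iff] at h
      rcases h with ⟨h, -⟩ | ⟨-, h⟩
      · exact hst.2.1 h
      · exact hst.2.2 h
  exact hvx hmem.1

theorem Reachable.exists_path_first {D : SimpleGraph V} {b s : V} (h : D.Reachable b s)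
    {S : Set V} (hs : s ∈ S) :
    ∃ y ∈ S, ∃ p : D.Walk b y, p.IsPath ∧ ∀ c ∈ p.support, c ∈ S → c = y := by
  classical
  suffices ∃ y ∈ S, ∃ p : D.Walk b y, ∀ c ∈ p.support, c ∈ S → c = y by
    obtain ⟨y, hy, p, hp⟩ := this
    exact ⟨y, hy, p.bypass, p.bypass_isPath,
      fun c hc => hp c (p.support_bypass_subset_support hc)⟩
  obtain ⟨p⟩ := h
  induction p with
  | nil => exact ⟨_, hs, .nil, fun c hc _ => by simpa using hc⟩
  | @cons b c s h p ih =>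
    by_cases hb : b ∈ S
    · exact ⟨b, hb, .nil, fun c hc _ => by simpa using hc⟩
    · obtain ⟨y, hy, q, hq⟩ := ih hs
      refine ⟨y, hy, .cons h q, fun d hd hdS => ?_⟩
      rw [Walk.support_cons, List.mem_cons] at hd
      rcases hd with rfl | hd
      · exact absurd hdS hb
      · exact hq d hd hdS

/-- A proper subgraph of a biconnected graph has an ear. -/
theorem IsBiconnected.exists_ear {G H : SimpleGraph V} (hG : G.IsBiconnected) (hHG : H ≤ G)
    (hne : H ≠ G) (hH : H.support.Nonempty) :
    ∃ (x y : V) (P : G.Walk x y), P.IsPath ∧ x ≠ y ∧ x ∈ H.support ∧ y ∈ H.support ∧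
      (∀ a ∈ P.support, a ∈ H.support → a = x ∨ a = y) ∧ ∃ e ∈ P.edges, e ∉ H.edgeSet := by
  obtain ⟨s, hs⟩ := hH
  obtain ⟨t, hst⟩ := hs
  obtain ⟨a, b, hab, hHab, ha⟩ : ∃ a b, G.Adj a b ∧ ¬ H.Adj a b ∧ a ∈ H.support := by
    by_contra! hcon
    refine hne (le_antisymm hHG fun a b hab => ?_)
    by_contra hHab
    have ha : a ∉ H.support := hcon a b hab hHab
    have hsa : a ≠ s := by
      rintro rfl; exact ha ⟨t, hst⟩
    obtain ⟨c, hc⟩ := hG.exists_adj s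
    have hr : G.Reachable s a := by
      by_cases hca : a = t
      · subst hca; exact (hHG hst).reachable
      · exact (hG.del_reachable (z := t) hst.ne hca).mono (deleteIncidenceSet_le _ _)
    have := mem_of_reachable_of_closed (s := H.support) hr ⟨t, hst⟩ fun c hc d hcd => by
      by_contra hd
      exact hcon c d hcd (fun h => hd ⟨c, h.symm⟩) hc
    exact ha this
  by_cases hb : b ∈ H.support
  · refine ⟨a, b, .cons hab .nil, by simp [hab.ne], hab.ne, ha, hb, ?_, s(a, b), by simp, hHab⟩
    intro c hc _
    simpa using hc
  -- The ear leaves `H` at `a` and returns, avoiding `a`, at the first vertex of `H` met on a walk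
  -- to `s'`.
  obtain ⟨s', hs', hs'a⟩ : ∃ s' ∈ H.support, s' ≠ a := by
    by_cases hsa : s = a
    · exact ⟨t, ⟨s, hst.symm⟩, hsa ▸ hst.ne'⟩
    · exact ⟨s, ⟨t, hst⟩, hsa⟩
  obtain ⟨y, hy, p, hp, hfirst⟩ :=
    (hG.del_reachable (z := a) hab.ne' hs'a).exists_path_first (S := H.support) hs'
  have hap : ∀ c ∈ p.support, c ≠ a := fun c hc => by
    classical
    exact ne_of_del_reachable ⟨p.takeUntil c hc⟩ hab.ne'
  have hsup : (p.mapLe (deleteIncidenceSet_le G a)).support = p.support := by simp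
  refine ⟨a, y, .cons hab (p.mapLe (deleteIncidenceSet_le G a)), ?_, ?_, ha, hy, ?_, s(a, b), ?_,
    hHab⟩
  · rw [Walk.cons_isPath_iff, hsup]
    exact ⟨hp.mapLe _, fun h => hap a h rfl⟩
  · exact (hap y p.end_mem_support).symm
  · intro c hc hcH
    rw [Walk.support_cons, List.mem_cons, hsup] at hc
    exact hc.imp id fun h => hfirst c h hcH
  · simp

/-! ### Adding an ear -/

/-- The graph `H` together with the edges of the walk `P`. -/
abbrev addWalk (H : SimpleGraph V) {G : SimpleGraph V} {x y : V} (P : G.Walk x y) :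
    SimpleGraph V :=
  H ⊔ fromEdgeSet {e | e ∈ P.edges}

section Ear

variable {G H : SimpleGraph V} {x y : V} {P : G.Walk x y}

theorem addWalk_le (hHG : H ≤ G) : H.addWalk P ≤ G := by
  refine sup_le hHG ?_
  intro a b hab
  rw [fromEdgeSet_adj] at hab
  exact P.adj_of_mem_edges hab.1

/-- A deleted vertex `z` cannot lie on both halves of the ear at another ear vertex, so that vertex
still reaches an end of the ear in `H`. -/
theorem NoCut.addWalk (hH : H.NoCut) (hP : P.IsPath) (hx : x ∈ H.support) (hy : y ∈ H.support) :
    (H.addWalk P).NoCut := by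
  have hedge : ∀ e ∈ P.edges, e ∈ (H.addWalk P).edgeSet := by
    intro e he
    induction e with
    | _ s t =>
      rw [mem_edgeSet, sup_adj, fromEdgeSet_adj]
      exact Or.inr ⟨he, (P.adj_of_mem_edges he).ne⟩
  have key : ∀ z a, a ∈ P.support → a ≠ z →
      ∃ e ∈ H.support, e ≠ z ∧ ((H.addWalk P).del z).Reachable a e := by
    intro z a ha haz
    obtain ⟨q, r, -, -, hqr⟩ := hP.mem_support_iff_exists_append.1 ha
    have hq : ∀ e ∈ q.edges, e ∈ (H.addWalk P).edgeSet := fun e he =>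
      hedge e (by rw [hqr, Walk.edges_append]; exact List.mem_append_left _ he)
    have hr : ∀ e ∈ r.edges, e ∈ (H.addWalk P).edgeSet := fun e he =>
      hedge e (by rw [hqr, Walk.edges_append]; exact List.mem_append_right _ he)
    by_cases hz : z ∈ q.support
    · have hz' : z ∉ r.support := fun hz' =>
        Walk.IsPath.ne_of_mem_support_of_append (hqr ▸ hP) haz.symm hz hz' rfl
      refine ⟨y, hy, fun h => hz' (h ▸ r.end_mem_support), ?_⟩
      exact (r.transfer _ hr).del_reachable_of_mem (by simpa using hz')
        (by simp)
    · refine ⟨x, hx, fun h => hz (h ▸ q.start_mem_support), ?_⟩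
      exact ((q.transfer _ hq).del_reachable_of_mem (by simpa using hz) (by simp)).symm
  have key' : ∀ z a, a ∈ (H.addWalk P).support → a ≠ z →
      ∃ e ∈ H.support, e ≠ z ∧ ((H.addWalk P).del z).Reachable a e := by
    rintro z a ⟨b, hab⟩ haz
    have hab : (H.addWalk P).Adj a b := hab
    rw [sup_adj, fromEdgeSet_adj] at hab
    rcases hab with hab | ⟨hab, -⟩
    · exact ⟨a, ⟨b, hab⟩, haz, Reachable.refl _⟩
    · exact key z a (P.fst_mem_support_of_mem_edges hab) haz
  intro z a b ha hb haz hbz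
  obtain ⟨e, he, hez, hae⟩ := key' z a ha haz
  obtain ⟨f, hf, hfz, hbf⟩ := key' z b hb hbz
  exact (hae.trans ((hH z e f he hf hez hfz).mono (del_mono le_sup_left z))).trans hbf.symm

/-- Once `y` is isolated in `H`, the ear meets the rest of `H` at most in `x`: it is a pendant path.
-/
theorem isAcyclic_del_addWalk (hP : P.IsPath)
    (hint : ∀ a ∈ P.support, a ∈ H.support → a = x ∨ a = y) (hy : (H.del y).IsAcyclic) :
    ((H.addWalk P).del y).IsAcyclic := by
  refine (hy.sup_pendant_path P hP ?_).anti ?_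
  · rintro a ha ⟨b, hab⟩
    have hab : (H.del y).Adj a b := hab
    rw [del_adj] at hab
    exact (hint a ha ⟨b, hab.1⟩).resolve_right hab.2.1
  · intro a b hab
    rw [del_adj, sup_adj] at hab
    rw [sup_adj, del_adj]
    exact hab.1.imp (fun h => ⟨h, hab.2⟩) id

theorem addWalk_reverse : H.addWalk P.reverse = H.addWalk P := by
  simp [addWalk]

/-- The interior of an ear is a link. -/
theorem exists_isLink_of_ear (hP : P.IsPath) (hxy : x ≠ y)
    (hint : ∀ a ∈ P.support, a ∈ H.support → a = x ∨ a = y) (he : ∃ e ∈ P.edges, e ∉ H.edgeSet) :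
    ∃ L : Set V, G.IsLink x y L ∧ Disjoint L H.support ∧ (L.Nonempty ∨ ¬ H.Adj x y) ∧
      x ∉ L := by
  cases P with
  | nil => exact absurd rfl hxy
  | @cons _ c _ h p =>
    rw [Walk.cons_isPath_iff] at hP
    obtain ⟨hp, hxp⟩ := hP
    by_cases hcy : c = y
    · subst hcy
      have hpn : p = .nil := by simpa using hp
      subst hpn
      refine ⟨∅, Or.inl ⟨rfl, h⟩, Set.empty_disjoint _, Or.inr fun hadj => ?_, by simp⟩
      obtain ⟨e, he, heH⟩ := he
      rw [Walk.edges_cons, Walk.edges_nil, List.mem_singleton] at he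
      exact heH (he ▸ hadj)
    have hp' : p.reverse.IsPath := (Walk.isPath_reverse_iff p).2 hp
    have hsup : ∀ a ∈ p.reverse.support, a ∈ p.support := fun a ha => by
      rwa [Walk.support_reverse, List.mem_reverse] at ha
    generalize p.reverse = r at hp' hsup
    cases r with
    | nil => exact absurd rfl hcy
    | @cons _ d _ h' q =>
      rw [Walk.cons_isPath_iff] at hp'
      have hxq : x ∉ q.support := fun hx => hxp (hsup x (by simp [hx]))
      refine ⟨{a | a ∈ q.support}, Or.inr ⟨q.connected_induce_support,
        ⟨x, rfl, c, q.end_mem_support, h⟩, ⟨d, q.start_mem_support, y, rfl, h'.symm⟩⟩, ?_,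
        Or.inl ⟨d, q.start_mem_support⟩, hxq⟩
      refine Set.disjoint_left.2 fun a ha haH => ?_
      have ha : a ∈ q.support := ha
      rcases hint a (by simp [hsup a (by simp [ha])]) haH with rfl | rfl
      · exact hxq ha
      · exact hp'.2 ha

end Ear

/-! ### The maximal subgraph with a hub -/

theorem noCut_edge (a b : V) : (edge a b).NoCut := by
  have hs : ∀ c ∈ (edge a b).support, c = a ∨ c = b := by
    rintro c ⟨d, hd⟩
    have hd : (edge a b).Adj c d := hd
    rw [edge_adj] at hd
    tauto
  intro z c d hc hd hcz hdz
  by_cases hcd : c = d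
  · rw [hcd]
  · refine Adj.reachable (del_adj.2 ⟨?_, hcz, hdz⟩)
    rw [edge_adj]
    refine ⟨?_, hcd⟩
    rcases hs c hc with rfl | rfl <;> rcases hs d hd with rfl | rfl <;> simp_all

theorem isAcyclic_del_of_induce {G : SimpleGraph V} {v : V} (h : (G.del v).IsAcyclic) :
    (G.induce {v}ᶜ).IsAcyclic :=
  h.comap (G := G.induce {v}ᶜ)
    { toFun := Subtype.val, map_rel' := fun {a b} hab => del_adj.2 ⟨hab, a.2, b.2⟩ }
    Subtype.val_injective

/-- A biconnected graph in which no vertex meets all cycles contains one of the three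
obstructions. -/
theorem IsBiconnectedWithoutHub.exists_isMinorOf [Finite V] {G : SimpleGraph V}
    (hG : G.IsBiconnectedWithoutHub) :
    (⊤ : SimpleGraph (Fin 4)).IsMinorOf G ∨ FinGraph.threeSun.IsMinorOf G ∨
      FinGraph.twoJoinedTriangles.IsMinorOf G := by
  obtain ⟨hbic, hhub⟩ := hG
  let F : Set (SimpleGraph V) :=
    {H | H ≤ G ∧ H.NoCut ∧ ∃ v ∈ H.support, (H.del v).IsAcyclic}
  have hFne : F.Nonempty := by
    have := hbic.1
    obtain ⟨a⟩ : Nonempty V := inferInstance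
    obtain ⟨b, hab⟩ := hbic.exists_adj a
    refine ⟨edge a b, ?_, noCut_edge a b, a, ⟨b, ?_⟩, ?_⟩
    · exact (edge_le_iff G).2 (Or.inr hab)
    · exact (edge_adj ..).2 ⟨Or.inl ⟨rfl, rfl⟩, hab.ne⟩
    · convert isAcyclic_bot
      rw [eq_bot_iff_forall_not_adj]
      intro c d hcd
      rw [del_adj, edge_adj] at hcd
      tauto
  obtain ⟨H, hHmax⟩ := (Set.toFinite F).exists_maximal hFne
  obtain ⟨hHG, hH, v, hv, hacyc⟩ := hHmax.prop
  have hne : H ≠ G := by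
    rintro rfl
    exact hhub v (isAcyclic_del_of_induce hacyc)
  obtain ⟨x, y, P, hP, hxy, hx, hy, hint, he⟩ := hbic.exists_ear hHG hne ⟨v, hv⟩
  -- A hub of `H` with the ear would put a strictly larger graph into `F`.
  have hfail : ∀ w ∈ H.support, ¬ ((H.addWalk P).del w).IsAcyclic := by
    rintro w ⟨w', hw⟩ hcon
    have hle := hHmax.le_of_ge (y := H.addWalk P) ⟨addWalk_le hHG, hH.addWalk hP hx hy, w,
      ⟨w', Or.inl hw⟩, hcon⟩ le_sup_left
    obtain ⟨e, heP, heH⟩ := he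
    induction e with
    | _ s t =>
      exact heH (hle (Or.inr ((fromEdgeSet_adj _).2 ⟨heP, (P.adj_of_mem_edges heP).ne⟩)))
  have hfy : ¬ (H.del y).IsAcyclic := fun h => hfail y hy (isAcyclic_del_addWalk hP hint h)
  have hfx : ¬ (H.del x).IsAcyclic := fun h => by
    refine hfail x hx ?_
    rw [← addWalk_reverse]
    refine isAcyclic_del_addWalk ((Walk.isPath_reverse_iff P).2 hP) (fun a ha haH => ?_) h
    rw [Walk.support_reverse, List.mem_reverse] at ha
    exact (hint a ha haH).symm
  have hxv : x ≠ v := by rintro rfl; exact hfx hacyc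
  have hyv : y ≠ v := by rintro rfl; exact hfy hacyc
  have hr : (H.del v).Reachable x y := hH v x y hx hy hxv hyv
  -- Every cycle of `H - z` passes through `v`, so its rest joins two neighbours of `v` outside `v`
  -- and `z`.
  have hnbr : ∀ z, z ∈ H.support → ¬ (H.del z).IsAcyclic → ∃ p ∈ {n | H.Adj v n},
      ∃ q ∈ {n | H.Adj v n}, p ≠ q ∧ ((H.del v).del z).Reachable p q := by
    intro z hz hzc
    obtain ⟨p, q, hpq, hp, hq, hpqr⟩ := exists_reachable_neighbors hzc
      (v := v) (by rw [del_comm]; exact hacyc.anti (deleteIncidenceSet_le _ _))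
    rw [del_comm] at hpqr
    exact ⟨p, (del_adj.1 hp).1, q, (del_adj.1 hq).1, hpq, hpqr⟩
  obtain ⟨L, hL, hLH, hLne, hxL⟩ := exists_isLink_of_ear hP hxy hint he
  refine isMinorOf_of_side_links (T := H.del v) ((deleteIncidenceSet_le _ _).trans hHG)
    (N := {n | H.Adj v n}) hxy hr ?_ (fun h => hxv (eq_of_del_reachable h)) ?_ ?_ hL ?_ ?_ ?_
    (hnbr x hx hfx) (hnbr y hy hfy)
  · intro n hn
    have hn : H.Adj v n := hn
    exact ⟨hHG hn, hH v n x ⟨v, hn.symm⟩ hx hn.ne' hxv⟩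
  · obtain ⟨n, hn, hvn⟩ := hH.exists_adj_mem_side hv hx hxv hxy hacyc hr
    exact ⟨n, hvn, hn⟩
  · obtain ⟨n, hn, hvn⟩ := hH.exists_adj_mem_side hv hy hyv hxy.symm hacyc hr.symm
    exact ⟨n, hvn, hn⟩
  · intro a ha
    refine not_reachable_of_notMem_support ?_ (fun h => hxL (h ▸ ha))
    rintro ⟨b, hab⟩
    exact Set.disjoint_left.1 hLH ha ⟨b, (del_adj.1 hab).1⟩
  · exact fun h => Set.disjoint_left.1 hLH h hv
  · exact hLne.imp id fun h hadj => h (del_adj.1 hadj).1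

/-- A cycle can be contracted to a triangle. -/
theorem triangle_isMinorOf_of_not_isAcyclic {G : SimpleGraph V} (h : ¬ G.IsAcyclic) :
    (⊤ : SimpleGraph (Fin 3)).IsMinorOf G := by
  simp only [IsAcyclic, not_forall, not_not] at h
  obtain ⟨a, c, hc⟩ := h
  obtain ⟨u, w, q, hne, hu, hw, haq, -⟩ := hc.exists_path_avoiding c.start_mem_support
  have hr : (G.del a).Reachable u w := q.del_reachable_of_mem haq q.end_mem_support
  obtain ⟨α, β, huα, hwβ, hα, hβ, hαβ, ht, hun⟩ :=
    exists_split (deleteIncidenceSet_le G a) hr hne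
  have ha : a ∉ α ∪ β := by
    rw [hun]
    exact fun h => hu.ne' (eq_of_del_reachable (Reachable.symm h))
  rw [Set.mem_union, not_or] at ha
  refine isMinorOf_of_lt ![{a}, α, β] ?_ ?_ ?_
  · intro i
    fin_cases i
    · exact connected_induce_singleton G a
    · exact hα
    · exact hβ
  · intro i j hij
    fin_cases i <;> fin_cases j <;> first | exact absurd hij (by decide) | skip
    · exact Set.disjoint_singleton_left.2 ha.1
    · exact Set.disjoint_singleton_left.2 ha.2
    · exact hαβ
  · intro i j hij _
    fin_cases i <;> fin_cases j <;> first | exact absurd hij (by decide) | skip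
    · exact ⟨a, rfl, u, huα, hu⟩
    · exact ⟨a, rfl, w, hwβ, hw⟩
    · exact ht

end SimpleGraph

/-! ### The obstruction sets -/

namespace FinGraph

open SimpleGraph

/-- A copy of a graph on `Fin n` in an arbitrary universe. -/
def ofFin {n : ℕ} (Z : SimpleGraph (Fin n)) : FinGraph.{u} where
  V := ULift.{u} (Fin n)
  graph := Z.comap ULift.down

theorem isoTo_ofFin {n : ℕ} (Z : SimpleGraph (Fin n)) : (ofFin.{u} Z).IsoTo Z :=
  ⟨⟨Equiv.ulift, Iff.rfl⟩⟩

theorem IsoTo.isMinorOf {G : FinGraph.{u}} {W : Type*} {Z : SimpleGraph W} (h : G.IsoTo Z) :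
    G.graph.IsMinorOf Z :=
  let ⟨e⟩ := h; .of_iso e

/-- If `G` is minor-minimal outside `𝒬` and has a minor `Z` outside `𝒬`, then `G` is `Z`. -/
theorem isoTo_of_mem_obs {𝒬 : Set FinGraph.{u}} {G : FinGraph.{u}} (hG : G ∈ obs 𝒬) {n : ℕ}
    {Z : SimpleGraph (Fin n)} (hZ : ∀ G : FinGraph.{u}, G.IsoTo Z → G ∉ 𝒬)
    (h : Z.IsMinorOf G.graph) : G.IsoTo Z := by
  obtain ⟨e⟩ := hG.2 (ofFin Z) ((isoTo_ofFin Z).isMinorOf.trans h) (hZ _ (isoTo_ofFin Z))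
  obtain ⟨f⟩ := isoTo_ofFin.{u} Z
  exact ⟨e.symm.trans f⟩

/-- A graph outside `𝒬` is an obstruction if it is a minor of each of its minors outside `𝒬`. -/
theorem mem_obs_of_isoTo {𝒬 : Set FinGraph.{u}} {G : FinGraph.{u}} {n : ℕ}
    {Z : SimpleGraph (Fin n)} (hZ : ∀ G : FinGraph.{u}, G.IsoTo Z → G ∉ 𝒬) (hG : G.IsoTo Z)
    (h : ∀ H : FinGraph.{u}, H.graph.IsMinorOf Z → H ∉ 𝒬 → Z.IsMinorOf H.graph) :
    G ∈ obs 𝒬 := by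
  refine ⟨hZ G hG, fun H hHG hH => ?_⟩
  have hHG : H.graph.IsMinorOf G.graph := hHG
  exact hHG.antisymm (hG.isMinorOf.trans (h H (hHG.trans hG.isMinorOf) hH))

theorem notMem_bedLE_one_of_isoTo {G : FinGraph.{u}} (h : G.IsoTo (⊤ : SimpleGraph (Fin 3))) :
    G ∉ bedLE edgeless.{u} 1 := by
  obtain ⟨e⟩ := h
  rw [mem_bedLE_one_iff, e.isAcyclic_iff]
  exact not_isAcyclic_of_triangle (a := 0) (b := 1) (c := 2) (by decide) (by decide) (by decide)

theorem notMem_bedLE_two_of_isoTo {W : Type*} {Z : SimpleGraph W}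
    (hZ : Z.IsBiconnectedWithoutHub) {G : FinGraph.{u}} (h : G.IsoTo Z) :
    G ∉ bedLE edgeless.{u} 2 := by
  obtain ⟨e⟩ := h
  intro hG
  have hG : G.bed edgeless ≤ 2 := hG
  exact absurd ((three_le_bed (hZ.of_iso e.symm)).trans hG) (by decide)

theorem exists_isMinorOf_of_notMem_bedLE_two {G : FinGraph.{u}} (h : G ∉ bedLE edgeless.{u} 2) :
    (⊤ : SimpleGraph (Fin 4)).IsMinorOf G.graph ∨ threeSun.IsMinorOf G.graph ∨
      twoJoinedTriangles.IsMinorOf G.graph := by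
  obtain ⟨Y, hY, hhub⟩ := exists_isMinorOf_of_not_mem_bedLE_two h
  exact hhub.exists_isMinorOf.imp (fun h => h.trans hY)
    (Or.imp (fun h => h.trans hY) fun h => h.trans hY)

theorem not_isMinorOf_of_lt {m n : ℕ} (hmn : m < n) {Z : SimpleGraph (Fin n)}
    {Z' : SimpleGraph (Fin m)} : ¬ Z.IsMinorOf Z' := fun h =>
  absurd h.card_le (by simpa using hmn)

end FinGraph

theorem mainTheorem9 :
    FinGraph.obs (FinGraph.bedLE FinGraph.edgeless.{u} 1) =
      {G : FinGraph.{u} | G.IsoTo (⊤ : SimpleGraph (Fin 3))} ∧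
    FinGraph.obs (FinGraph.bedLE FinGraph.edgeless.{u} 2) =
      {G : FinGraph.{u} | G.IsoTo FinGraph.threeSun ∨ G.IsoTo (⊤ : SimpleGraph (Fin 4)) ∨
        G.IsoTo FinGraph.twoJoinedTriangles} ∧
    ¬ Nonempty (FinGraph.threeSun ≃g FinGraph.twoJoinedTriangles) := by
  refine ⟨Set.Subset.antisymm (fun G hG => ?_) (fun G hG => ?_),
    Set.Subset.antisymm (fun G hG => ?_) (fun G hG => ?_), fun ⟨e⟩ =>
      FinGraph.not_threeSun_isMinorOf_twoJoinedTriangles (.of_iso e)⟩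
  · refine FinGraph.isoTo_of_mem_obs hG (fun _ => FinGraph.notMem_bedLE_one_of_isoTo) ?_
    exact SimpleGraph.triangle_isMinorOf_of_not_isAcyclic
      fun h => hG.1 (FinGraph.mem_bedLE_one_iff.2 h)
  · refine FinGraph.mem_obs_of_isoTo (fun _ => FinGraph.notMem_bedLE_one_of_isoTo) hG
      fun H _ hH => ?_
    exact SimpleGraph.triangle_isMinorOf_of_not_isAcyclic
      fun h => hH (FinGraph.mem_bedLE_one_iff.2 h)
  · rcases FinGraph.exists_isMinorOf_of_notMem_bedLE_two hG.1 with h | h | h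
    · exact Or.inr (Or.inl (FinGraph.isoTo_of_mem_obs hG (fun _ =>
        FinGraph.notMem_bedLE_two_of_isoTo FinGraph.completeGraph_four_isBiconnectedWithoutHub) h))
    · exact Or.inl (FinGraph.isoTo_of_mem_obs hG (fun _ =>
        FinGraph.notMem_bedLE_two_of_isoTo FinGraph.threeSun_isBiconnectedWithoutHub) h)
    · exact Or.inr (Or.inr (FinGraph.isoTo_of_mem_obs hG (fun _ =>
        FinGraph.notMem_bedLE_two_of_isoTo
          FinGraph.twoJoinedTriangles_isBiconnectedWithoutHub) h))
  · rcases hG with hG | hG | hG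
    · refine FinGraph.mem_obs_of_isoTo (fun _ => FinGraph.notMem_bedLE_two_of_isoTo
        FinGraph.threeSun_isBiconnectedWithoutHub) hG fun H hHZ hH => ?_
      rcases FinGraph.exists_isMinorOf_of_notMem_bedLE_two hH with h | h | h
      · exact absurd (h.trans hHZ) FinGraph.not_k4_isMinorOf_threeSun
      · exact h
      · exact absurd (h.trans hHZ) FinGraph.not_twoJoinedTriangles_isMinorOf_threeSun
    · refine FinGraph.mem_obs_of_isoTo (fun _ => FinGraph.notMem_bedLE_two_of_isoTo
        FinGraph.completeGraph_four_isBiconnectedWithoutHub) hG fun H hHZ hH => ?_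
      rcases FinGraph.exists_isMinorOf_of_notMem_bedLE_two hH with h | h | h
      · exact h
      · exact absurd (h.trans hHZ) (FinGraph.not_isMinorOf_of_lt (by decide))
      · exact absurd (h.trans hHZ) (FinGraph.not_isMinorOf_of_lt (by decide))
    · refine FinGraph.mem_obs_of_isoTo (fun _ => FinGraph.notMem_bedLE_two_of_isoTo
        FinGraph.twoJoinedTriangles_isBiconnectedWithoutHub) hG fun H hHZ hH => ?_
      rcases FinGraph.exists_isMinorOf_of_notMem_bedLE_two hH with h | h | h
      · exact absurd (h.trans hHZ) FinGraph.not_k4_isMinorOf_twoJoinedTriangles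
      · exact absurd (h.trans hHZ) FinGraph.not_threeSun_isMinorOf_twoJoinedTriangles
      · exact h
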